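/- **Theorem (unconditional law of the sphere-reflected random flight).** Let $h\in\{1,2\}$ and let $d>h$ be an integer (so $d\ge 2$ if $h=1$ and $d\ge 3$ if $h=2$). Let $c,R,\lambda>0$ and $t>R/c$. *The free flight.* Let $0=t_0<t_1<t_2<\cdots$ be random instants and $V_1,V_2,\dots$ independent random vectors, uniformly distributed on the unit sphere of $\mathbb R^d$ and independent of the sequence $(t_k)$. Put $\tau_k=t_k-t_{k-1}$ and $\mathcal N(t)=\sup\{k\ge 1: t_k\le t\}$ (with $\sup\varnothing=0$). The position at time $t$ of the particle that starts at the origin, moves with speed $c$ and takes direction $V_k$ at the instant $t_{k-1}$ is, on $\{\mathcal N(t)=n\}$, $$X_d(t)=c\sum_{k=1}^{n}\tau_kV_k+c\,(t-t_n)\,V_{n+1}.$$ *Dirichlet displacements.* Assume that for each $n\ge 1$, conditionally on $\mathcal N(t)=n$, the vector $(\tau_1,\dots,\tau_n)$ has on the simplex $\{0<\tau_k<t-\sum_{j<k}\tau_j,\ k=1,\dots,n\}$ the density $$\frac{\Gamma\big((n+1)(\frac dh-1)\big)}{\Gamma(\frac dh-1)^{n+1}}\,\frac{1}{t^{(n+1)(\frac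 dh-1)-1}}\Big(\prod_{k=1}^{n}\tau_k^{\frac dh-2}\Big)\Big(t-\sum_{j=1}^n\tau_j\Big)^{\frac dh-2}.$$ *Number of deviations.* With $E_{\alpha,\beta}(x)=\sum_{k\ge 0}\frac{x^k}{\Gamma(\alpha k+\beta)}$, assume $$P\{\mathcal N(t)=n\}=\frac{1}{E_{\frac{d-h}2,\frac d2}(\lambda t)}\,\frac{(\lambda t)^n}{\Gamma(\frac{d-h}{2}n+\frac d2)},\qquad n=0,1,2,\dots$$ *The reflected flight.* Let $\mu_R(x)=R^2x/\|x\|^2$, let $B_R$ be the open ball of radius $R$ centred at the origin, and let $C_{a,b}=\{x: a<\|x\|\le b\}$. For $t>R/c$ set $$X_d^*(t)=X_d(t)\mathbf 1_{B_R}(X_d(t))+\mu_R(X_d(t))\mathbf 1_{C_{R,ct}}(X_d(t))\quad\text{if }\mathcal N(t)\ge 1,$$ $$X_d^*(t)=\mu_R(X_d(t))\mathbf 1_{\{\|x\|=ct\}}(X_d(t))\quad\text{if }\mathcal N(t)=0.$$ *Conclusion.* The law of $X^*_d(t)$ is $$P\{X_d^*(t)\in dx\}=p_h^*(x,t)\,dx+\frac{1}{E_{\frac{d-h}{2},\frac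 d2}(\lambda t)\,\Gamma(\frac d2)}\,\mu^*(dx),$$ where $\mu^*$ is the uniform probability distribution on the sphere of radius $R^2/(ct)$ centred at the origin and $$p_h^*(x,t)=\frac{(\lambda t)^{\frac{2}{d-h}}}{(ct)^d\pi^{d/2}E_{\frac{d-h}{2},\frac d2}(\lambda t)}\Big\{\gamma_h(\|x\|,t)^{1-\frac2{d-h}}E_{\frac{d-h}2,\frac{d-h}2}\big(\gamma_h(\|x\|,t)\big)\mathbf 1_{B_R}(x)$$ $$\qquad+\frac{R^{2d}}{\|x\|^{2d}}\,\gamma_h\big(\tfrac{R^2}{\|x\|},t\big)^{1-\frac2{d-h}}E_{\frac{d-h}2,\frac{d-h}2}\big(\gamma_h(\tfrac{R^2}{\|x\|},t)\big)\mathbf 1_{C_{R^2/(ct),R}}(x)\Big\},$$ $$\gamma_h(r,t)=\lambda t\Big(1-\frac{r^2}{c^2t^2}\Big)^{\frac{d-h}{2}}.$$ -/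

import Mathlib

open MeasureTheory ProbabilityTheory

noncomputable section

/-- The two-parameter Mittag-Leffler function `E_{α,β}(x) = ∑ k, x ^ k / Γ(α k + β)`. -/
def mittagLeffler (α β x : ℝ) : ℝ :=
  ∑' k : ℕ, x ^ k / Real.Gamma (α * (k : ℝ) + β)

/-- The uniform probability law on the sphere of radius `r` centred at the origin of `ℝ^d`:
the normalised surface measure of the unit sphere, scaled by `r`. -/
def uniformSphere (d : ℕ) (r : ℝ) : Measure (EuclideanSpace ℝ (Fin d)) :=
  (ProbabilityTheory.cond
      (Measure.toSphere (volume : Measure (EuclideanSpace ℝ (Fin d)))) Set.univ).map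
    (fun v : Metric.sphere (0 : EuclideanSpace ℝ (Fin d)) 1 =>
      r • (v : EuclideanSpace ℝ (Fin d)))

/-- The open simplex of vectors `(τ_1, …, τ_n)` with `0 < τ_k < t - ∑_{j < k} τ_j`. -/
def timeSimplex (n : ℕ) (t : ℝ) : Set (Fin n → ℝ) :=
  {τ | ∀ k : Fin n, 0 < τ k ∧ τ k < t - ∑ j ∈ Finset.Iio k, τ j}

/-- The symmetric Dirichlet density with parameters `(q, …, q)` (`n + 1` entries) on the simplex
of total length `t`, where `τ_{n+1} = t - ∑ τ_j`. -/
def dirichletDensity (q : ℝ) (n : ℕ) (t : ℝ) : (Fin n → ℝ) → ℝ :=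
  (timeSimplex n t).indicator fun τ =>
    Real.Gamma (((n : ℝ) + 1) * q) / Real.Gamma q ^ (n + 1)
      * (1 / t ^ (((n : ℝ) + 1) * q - 1))
      * ((∏ k, τ k ^ (q - 1)) * (t - ∑ j, τ j) ^ (q - 1))

/-- The Dirichlet law of `(τ_1, …, τ_n)`. -/
def dirichletLaw (q : ℝ) (n : ℕ) (t : ℝ) : Measure (Fin n → ℝ) :=
  volume.withDensity fun τ => ENNReal.ofReal (dirichletDensity q n t τ)

/-- The number `N(t) = sup {k ≥ 1 : t_k ≤ t}` of changes of direction in `[0,t]`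
(the supremum is taken in `ℕ ∪ {∞}`, and is `0` if there is no such `k`). -/
def numDeviations {Ω : Type*} (T : ℕ → Ω → ℝ) (t : ℝ) (ω : Ω) : ℕ∞ :=
  ⨆ k ∈ {k : ℕ | 1 ≤ k ∧ T k ω ≤ t}, (k : ℕ∞)

/-- The data of a random flight in `ℝ^d`: strictly increasing random instants
`0 = t_0 < t_1 < t_2 < …` (`T k = t_k`), and directions (`V k` is the direction chosen at time
`t_k`) which are independent, uniform on the unit sphere, and independent of the instants. -/
structure IsRandomFlight {Ω : Type*} [MeasurableSpace Ω] (P : Measure Ω) {d : ℕ}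
    (T : ℕ → Ω → ℝ) (V : ℕ → Ω → EuclideanSpace ℝ (Fin d)) : Prop where
  measurable_time : ∀ k, Measurable (T k)
  measurable_dir : ∀ k, Measurable (V k)
  time_zero : ∀ ω, T 0 ω = 0
  time_strictMono : ∀ ω, StrictMono fun k => T k ω
  dir_uniform : ∀ k, P.map (V k) = uniformSphere d 1
  dir_indep : iIndepFun V P
  indep_time_dir : IndepFun (fun ω k => T k ω) (fun ω k => V k ω) P

/-- The position at time `t` of the particle which starts at the origin and moves with speed `c`:
`X(t) = c ∑_{k=1}^{N(t)+1} τ_k V_k`, where `τ_k = t_k - t_{k-1}` for `k ≤ N(t)` and the last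
displacement has duration `t - t_{N(t)}`. -/
def flightPosition {Ω : Type*} {d : ℕ} (c : ℝ) (T : ℕ → Ω → ℝ)
    (V : ℕ → Ω → EuclideanSpace ℝ (Fin d)) (t : ℝ) (ω : Ω) : EuclideanSpace ℝ (Fin d) :=
  let n := (numDeviations T t ω).toNat
  c • (∑ k ∈ Finset.range n, (T (k + 1) ω - T k ω) • V k ω + (t - T n ω) • V n ω)

/-- The half-open shell `{x : a < ‖x‖ ≤ b}`. -/
def shell (d : ℕ) (a b : ℝ) : Set (EuclideanSpace ℝ (Fin d)) :=
  {x | a < ‖x‖ ∧ ‖x‖ ≤ b}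

open Classical in
/-- The flight reflected by inversion in the sphere of radius `R`. -/
def reflectedPosition {Ω : Type*} {d : ℕ} (R c : ℝ) (T : ℕ → Ω → ℝ)
    (V : ℕ → Ω → EuclideanSpace ℝ (Fin d)) (t : ℝ) (ω : Ω) : EuclideanSpace ℝ (Fin d) :=
  let x := flightPosition c T V t ω
  if t ≤ R / c then x
  else if 1 ≤ numDeviations T t ω then
    (Metric.ball 0 R).indicator id x
      + (shell d R (c * t)).indicator (EuclideanGeometry.inversion 0 R) x
  else
    (Metric.sphere 0 (c * t)).indicator (EuclideanGeometry.inversion 0 R) x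

/-- Dirichlet displacements at time `t`: given `N(t) = n ≥ 1`, the vector `(τ_1, …, τ_n)` has the
Dirichlet law with all parameters equal to `d / h - 1`. -/
def HasDirichletDisplacements {Ω : Type*} [MeasurableSpace Ω] (P : Measure Ω)
    (T : ℕ → Ω → ℝ) (d h : ℕ) (t : ℝ) : Prop :=
  ∀ n : ℕ, 1 ≤ n →
    (ProbabilityTheory.cond P {ω | numDeviations T t ω = n}).map
        (fun ω (k : Fin n) => T ((k : ℕ) + 1) ω - T (k : ℕ) ω)
      = dirichletLaw ((d : ℝ) / h - 1) n t

/-- The weighted Poisson law of `N(t)`: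
`P(N(t) = n) = (λ t)^n / (Γ((d-h)/2 n + d/2) E_{(d-h)/2, d/2}(λ t))` for all `n ≥ 0`. -/
def HasWeightedPoissonDeviations {Ω : Type*} [MeasurableSpace Ω] (P : Measure Ω)
    (T : ℕ → Ω → ℝ) (d h : ℕ) (lam t : ℝ) : Prop :=
  ∀ n : ℕ, P {ω | numDeviations T t ω = n} =
    ENNReal.ofReal (1 / mittagLeffler (((d : ℝ) - h) / 2) ((d : ℝ) / 2) (lam * t)
      * ((lam * t) ^ n / Real.Gamma (((d : ℝ) - h) / 2 * (n : ℝ) + (d : ℝ) / 2)))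

/-- `γ_h(r,t) = λ t (1 - r² / (c² t²))^{(d-h)/2}`. -/
def gammaH (d h : ℕ) (lam c r t : ℝ) : ℝ :=
  lam * t * (1 - r ^ 2 / (c ^ 2 * t ^ 2)) ^ (((d : ℝ) - h) / 2)

/-- The factor `γ^{1 - 2/(d-h)} E_{(d-h)/2,(d-h)/2}(γ)` at `γ = γ_h(r,t)`. -/
def radialFactor (d h : ℕ) (lam c r t : ℝ) : ℝ :=
  gammaH d h lam c r t ^ (1 - 2 / ((d : ℝ) - h))
    * mittagLeffler (((d : ℝ) - h) / 2) (((d : ℝ) - h) / 2) (gammaH d h lam c r t)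

/-- The density of the absolutely continuous part of the law of the reflected flight. -/
def reflectedDensity (d h : ℕ) (lam c R t : ℝ) (x : EuclideanSpace ℝ (Fin d)) : ℝ :=
  (lam * t) ^ (2 / ((d : ℝ) - h)) / ((c * t) ^ d * Real.pi ^ ((d : ℝ) / 2))
    * (1 / mittagLeffler (((d : ℝ) - h) / 2) ((d : ℝ) / 2) (lam * t))
    * ((Metric.ball 0 R).indicator (fun y => radialFactor d h lam c ‖y‖ t) x
      + (shell d (R ^ 2 / (c * t)) R).indicator
          (fun y => R ^ (2 * d) / ‖y‖ ^ (2 * d) * radialFactor d h lam c (R ^ 2 / ‖y‖) t) x)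

end

/-!
The proof computes the law of the free flight given the number `n` of deviations, averages it over
`n`, and pushes the result through the reflection.

*Given `n ≥ 1` deviations.* The position is `c ∑ τ_k V_k` with Dirichlet durations (all `n + 1`
parameters equal to `q = d / h - 1`) and independent uniform directions. It is bounded, so its law
is determined by the moments of its linear forms (`ext_of_inner_moments`). Expanding
`(∑ τ_k ⟪w, V_k⟫)^m` and using the mixed moments of the Dirichlet law
(`integral_dirichletLaw_prod_pow`) shows that, up to the factor `((n + 1) q)_m / m!`, the `m`-th
moment is the `m`-th coefficient of the `(n + 1)`-st power of
`momentSeries h q = ∑ (q)_m s_m z^m / m!`, where `s_m` are the moments of a coordinate of a uniform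
vector of the unit sphere of `ℝ^d` (`integral_uniformSphere_inner_pow`). For `h = 1` this series is
`(1 - z²)^(-q/2)`, for `h = 2` it is `((1 + √(1 - z²)) / 2)^(-q)`; this is where the values of `h`
enter. So in both cases its powers are `momentSeries h ((n + 1) q)` (`momentSeries_pow`). Hence the
moments are those of a coordinate of a uniform vector of the sphere of radius `c t` of
`ℝ^(d + n (d - h))`, and these are the moments of the density proportional to
`(c² t² - ‖x‖²)^(n (d - h) / 2 - 1)` on the ball of radius `c t` (`map_flightMap`).
The convolution identity behind `momentSeries_pow` is obtained from a difference equation in `q`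
(`convolution_of_difference_equation`).

*Averaging.* The Gamma factors of these densities cancel those of the law of `N(t)`, and the sum
over `n ≥ 1` is a Mittag-Leffler series (`hasSum_deviationWeight_mul_ballProfile`). The
event `N(t) = 0` gives the uniform law on the sphere of radius `c t`. The weights sum to `1` because
the Mittag-Leffler series converges (`summable_mittagLeffler`), so `N(t) = ∞` has probability `0`.

*Reflection.* The inversion has Jacobian `(R / ‖x‖)^(2d)` in absolute value, and maps the shell
between `R` and `c t` to the shell between `R² / (c t)` and `R` (`map_ballReflection`).
-/

noncomputable section

/-! ### Rising factorials and the convolution identity -/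

/-- The rising factorial `(x)_n = x (x + 1) ⋯ (x + n - 1)` of a real number. -/
def rising (x : ℝ) (n : ℕ) : ℝ := (ascPochhammer ℝ n).eval x

@[simp] lemma rising_zero (x : ℝ) : rising x 0 = 1 := by simp [rising]

lemma rising_succ (x : ℝ) (n : ℕ) : rising x (n + 1) = rising x n * (x + n) :=
  ascPochhammer_succ_eval n x

lemma rising_succ_left (x : ℝ) (n : ℕ) : rising x (n + 1) = x * rising (x + 1) n := by
  simp [rising, ascPochhammer_succ_left]

lemma rising_pos {x : ℝ} (hx : 0 < x) (n : ℕ) : 0 < rising x n := ascPochhammer_pos n x hx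

lemma rising_ne_zero {x : ℝ} (hx : 0 < x) (n : ℕ) : rising x n ≠ 0 := (rising_pos hx n).ne'

lemma rising_two_mul (x : ℝ) (n : ℕ) :
    rising x (2 * n) = 4 ^ n * rising (x / 2) n * rising ((x + 1) / 2) n := by
  induction n with
  | zero => simp
  | succ n ih =>
    rw [show 2 * (n + 1) = 2 * n + 1 + 1 by ring, rising_succ, rising_succ, ih, rising_succ,
      rising_succ]
    push_cast
    ring

lemma factorial_two_mul (n : ℕ) :
    ((2 * n).factorial : ℝ) = 4 ^ n * n.factorial * rising (1 / 2) n := by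
  induction n with
  | zero => simp
  | succ n ih =>
    rw [show 2 * (n + 1) = 2 * n + 1 + 1 by ring, Nat.factorial_succ, Nat.factorial_succ,
      Nat.factorial_succ, rising_succ]
    push_cast
    rw [ih]
    ring

lemma Gamma_add_natCast {x : ℝ} (hx : 0 < x) (n : ℕ) :
    Real.Gamma (x + n) = Real.Gamma x * rising x n := by
  induction n with
  | zero => simp
  | succ n ih =>
    rw [Nat.cast_succ, ← add_assoc, Real.Gamma_add_one (by positivity), ih, rising_succ]
    ring

open Polynomial in
/-- A family of polynomials with `e_0 = 1`, `e_j(0) = 0` for `j ≥ 1` and a difference equation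
`e_{j+1}(x + s) - e_{j+1}(x) = κ e_j(x + w)` is of convolution type. The defect of the convolution
identity is a polynomial in `x` which is periodic by induction on `j`, hence constant, and it
vanishes at `0`. -/
lemma convolution_of_difference_equation {e : ℕ → ℝ[X]} {s κ w : ℝ} (hs : 0 < s)
    (h0 : e 0 = 1) (hz : ∀ j, (e (j + 1)).eval 0 = 0)
    (hdiff : ∀ j x, (e (j + 1)).eval (x + s) - (e (j + 1)).eval x = κ * (e j).eval (x + w))
    (j : ℕ) (x y : ℝ) :
    ∑ i ∈ Finset.HasAntidiagonal.antidiagonal j, (e i.1).eval x * (e i.2).eval y =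
        (e j).eval (x + y) := by
  induction j generalizing x y with
  | zero => simp [h0]
  | succ j ih =>
    set D : ℝ[X] := ∑ i ∈ Finset.HasAntidiagonal.antidiagonal (j + 1), e i.1 * C ((e i.2).eval y)
      - (e (j + 1)).comp (X + C y) with hD
    have hDe : ∀ z, D.eval z = ∑ i ∈ Finset.HasAntidiagonal.antidiagonal (j + 1), (e i.1).eval z
        * (e i.2).eval y
        - (e (j + 1)).eval (z + y) := by
      intro z
      simp [hD, eval_finsetSum]
    have hper : ∀ z, D.eval (z + s) = D.eval z := by
      intro z
      have h1 : ∀ z, ∑ i ∈ Finset.HasAntidiagonal.antidiagonal (j + 1), (e i.1).eval z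
          * (e i.2).eval y
          = (e (j + 1)).eval y
            + ∑ i ∈ Finset.HasAntidiagonal.antidiagonal j, (e (i.1 + 1)).eval z
                * (e i.2).eval y := by
        intro z
        rw [Finset.Nat.sum_antidiagonal_succ]
        simp [h0]
      have h2 : ∑ i ∈ Finset.HasAntidiagonal.antidiagonal j, (e (i.1 + 1)).eval (z + s)
          * (e i.2).eval y
          - ∑ i ∈ Finset.HasAntidiagonal.antidiagonal j, (e (i.1 + 1)).eval z * (e i.2).eval y
          = κ * (e j).eval (z + w + y) := by
        rw [← ih, ← Finset.sum_sub_distrib, Finset.mul_sum]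
        refine Finset.sum_congr rfl fun i _ => ?_
        rw [← sub_mul, hdiff]
        ring
      have h3 := hdiff j (z + y)
      rw [hDe, hDe, h1, h1]
      rw [show z + y + s = z + s + y by ring, show z + y + w = z + w + y by ring] at h3
      linarith
    have hnat : ∀ k : ℕ, D.eval (k * s) = 0 := by
      intro k
      induction k with
      | zero =>
        rw [hDe, Finset.Nat.sum_antidiagonal_succ]
        simp [h0, hz]
      | succ k ihk =>
        rw [show ((k + 1 : ℕ) : ℝ) * s = k * s + s by push_cast; ring, hper, ihk]
    have hD0 : D = 0 := by
      refine Polynomial.eq_zero_of_infinite_isRoot D ?_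
      refine Set.Infinite.mono ?_ (Set.infinite_range_of_injective
        (f := fun k : ℕ => (k : ℝ) * s) ?_)
      · rintro _ ⟨k, rfl⟩
        exact hnat k
      · intro a b hab
        simpa [hs.ne'] using hab
    have := hDe x
    rw [hD0, eval_zero] at this
    linarith

/-! ### The moment series of the sphere -/

/-- The `m`-th moment of a coordinate of a uniform vector of the unit sphere of `ℝ^(2β)`:
`(1/2)_j / (β)_j` for `m = 2 j`, and `0` for odd `m`. The dimension need not be an integer. -/
def sphereMoment (β : ℝ) (m : ℕ) : ℝ :=
  if Even m then rising (1 / 2) (m / 2) / rising β (m / 2) else 0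

lemma sphereMoment_two_mul (β : ℝ) (j : ℕ) :
    sphereMoment β (2 * j) = rising (1 / 2) j / rising β j := by
  simp [sphereMoment]

lemma sphereMoment_of_odd (β : ℝ) {m : ℕ} (hm : ¬ Even m) : sphereMoment β m = 0 := by
  simp [sphereMoment, hm]

/-- The series `∑ (q)_m s_m z^m / m!`, with `s_m` the moments of the sphere of (fractional)
dimension `h (q + 1)`. Formally it is `𝔼 (1 - z v)^(-q)`, where `v` is a coordinate of a uniform
vector of that sphere. -/
def momentSeries (h q : ℝ) : PowerSeries ℝ :=
  PowerSeries.mk fun m => rising q m / m.factorial * sphereMoment (h * (q + 1) / 2) m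

lemma coeff_momentSeries (h q : ℝ) (m : ℕ) :
    PowerSeries.coeff m (momentSeries h q)
      = rising q m / m.factorial * sphereMoment (h * (q + 1) / 2) m := by
  simp [momentSeries]

open Polynomial in
/-- The coefficient of `z^(2j)` in `momentSeries 1 q = (1 - z²)^(-q/2)`, as a polynomial in `q`. -/
def binomialCoeffPoly (j : ℕ) : ℝ[X] :=
  C (1 / (j.factorial : ℝ)) * (ascPochhammer ℝ j).comp (C (1 / 2) * X)

open Polynomial in
/-- The coefficient of `z^(2j)` in `momentSeries 2 q = ((1 + √(1 - z²)) / 2)^(-q)`, as a polynomial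
in `q`. -/
def catalanCoeffPoly : ℕ → ℝ[X]
  | 0 => 1
  | j + 1 => C (1 / (4 ^ (j + 1) * ((j + 1).factorial : ℝ))) * X
      * (ascPochhammer ℝ j).comp (X + C ((j : ℝ) + 2))

lemma eval_binomialCoeffPoly (j : ℕ) (q : ℝ) :
    (binomialCoeffPoly j).eval q = rising (q / 2) j / j.factorial := by
  simp [binomialCoeffPoly, rising]
  ring_nf

lemma eval_catalanCoeffPoly_succ (j : ℕ) (q : ℝ) :
    (catalanCoeffPoly (j + 1)).eval q
      = q * rising (q + j + 2) j / (4 ^ (j + 1) * (j + 1).factorial) := by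
  simp [catalanCoeffPoly, rising]
  ring_nf

lemma coeff_momentSeries_one {q : ℝ} (hq : 0 < q) (j : ℕ) :
    PowerSeries.coeff (2 * j) (momentSeries 1 q) = (binomialCoeffPoly j).eval q := by
  rw [coeff_momentSeries, sphereMoment_two_mul, eval_binomialCoeffPoly, rising_two_mul,
    factorial_two_mul, one_mul]
  have h1 := rising_ne_zero (x := (q + 1) / 2) (by positivity) j
  have h2 := rising_ne_zero (x := 1 / 2) (by positivity) j
  field_simp

lemma rising_two_mul_succ (q : ℝ) (j : ℕ) :
    rising q (2 * (j + 1)) = q * rising (q + 1) (j + 1) * rising (q + j + 2) j := by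
  have key : ∀ (i k : ℕ) (x : ℝ), rising x (k + i) = rising x k * rising (x + k) i := by
    intro i k x
    induction i with
    | zero => simp
    | succ i ih => rw [← add_assoc, rising_succ, ih, rising_succ]; push_cast; ring
  rw [show 2 * (j + 1) = (j + 1 + j) + 1 by ring, rising_succ_left, key j (j + 1)]
  push_cast
  rw [show q + 1 + ((j : ℝ) + 1) = q + j + 2 by ring]
  ring

lemma coeff_momentSeries_two {q : ℝ} (hq : 0 < q) (j : ℕ) :
    PowerSeries.coeff (2 * j) (momentSeries 2 q) = (catalanCoeffPoly j).eval q := by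
  rw [coeff_momentSeries, sphereMoment_two_mul, factorial_two_mul]
  have h2 := rising_ne_zero (x := 1 / 2) (by positivity) j
  have h1 := rising_ne_zero (x := q + 1) (by positivity) j
  rw [show 2 * (q + 1) / 2 = q + 1 by ring]
  cases j with
  | zero => simp [catalanCoeffPoly]
  | succ j =>
    rw [eval_catalanCoeffPoly_succ, rising_two_mul_succ]
    field_simp

lemma coeff_momentSeries_of_odd (h q : ℝ) {m : ℕ} (hm : ¬ Even m) :
    PowerSeries.coeff m (momentSeries h q) = 0 := by
  rw [coeff_momentSeries, sphereMoment_of_odd _ hm, mul_zero]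

lemma sum_antidiagonal_two_mul (f : ℕ → ℕ → ℝ) (hf : ∀ a b, ¬ Even a → f a b = 0) (j : ℕ) :
    ∑ i ∈ Finset.HasAntidiagonal.antidiagonal (2 * j), f i.1 i.2
      = ∑ i ∈ Finset.HasAntidiagonal.antidiagonal j, f (2 * i.1) (2 * i.2) := by
  symm
  refine Finset.sum_of_injOn (fun i => (2 * i.1, 2 * i.2)) ?_ ?_ ?_ ?_
  · rintro ⟨a, b⟩ _ ⟨a', b'⟩ _ h
    simp only [Prod.mk.injEq] at h ⊢
    omega
  · rintro ⟨a, b⟩ h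
    simp only [Finset.mem_coe,
      Finset.HasAntidiagonal.mem_antidiagonal] at h ⊢
    omega
  · rintro ⟨a, b⟩ h h'
    apply hf
    rintro ⟨k, hk⟩
    simp only [Finset.HasAntidiagonal.mem_antidiagonal] at h hk
    refine h' ⟨(k, j - k), ?_, ?_⟩
    · simp only [Finset.mem_coe,
        Finset.HasAntidiagonal.mem_antidiagonal]
      omega
    · simp only [Prod.mk.injEq]
      omega
  · rintro ⟨a, b⟩ _
    rfl

lemma momentSeries_mul_of_convolution {h : ℝ} {e : ℕ → Polynomial ℝ}
    (he : ∀ q, 0 < q → ∀ j, PowerSeries.coeff (2 * j) (momentSeries h q) = (e j).eval q)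
    (hconv : ∀ (j : ℕ) (x y : ℝ), ∑ i ∈ Finset.HasAntidiagonal.antidiagonal j,
      (e i.1).eval x * (e i.2).eval y = (e j).eval (x + y))
    {p q : ℝ} (hp : 0 < p) (hq : 0 < q) :
    momentSeries h p * momentSeries h q = momentSeries h (p + q) := by
  ext m
  rw [PowerSeries.coeff_mul]
  rcases Nat.even_or_odd' m with ⟨j, rfl | rfl⟩
  · rw [sum_antidiagonal_two_mul (fun a b => PowerSeries.coeff a (momentSeries h p)
      * PowerSeries.coeff b (momentSeries h q)), he _ (by positivity), ← hconv]
    · exact Finset.sum_congr rfl fun i _ => by rw [he _ hp, he _ hq]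
    · intro a b ha
      rw [coeff_momentSeries_of_odd _ _ ha, zero_mul]
  · rw [coeff_momentSeries_of_odd h (p + q) (by simp)]
    refine Finset.sum_eq_zero fun i hi => ?_
    rw [Finset.HasAntidiagonal.mem_antidiagonal] at hi
    by_cases h1 : Even i.1
    · have h2 : ¬ Even i.2 := by
        rintro ⟨k, hk⟩
        obtain ⟨l, hl⟩ := h1
        omega
      rw [coeff_momentSeries_of_odd _ _ h2, mul_zero]
    · rw [coeff_momentSeries_of_odd _ _ h1, zero_mul]

/-- The moment series is a one-parameter semigroup in `q`: for `h = 1` this is the Vandermonde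
convolution, for `h = 2` the Rothe–Hagen convolution for powers of the Catalan series. -/
lemma momentSeries_mul {h : ℕ} (hh : h = 1 ∨ h = 2) {p q : ℝ} (hp : 0 < p) (hq : 0 < q) :
    momentSeries h p * momentSeries h q = momentSeries h (p + q) := by
  rcases hh with rfl | rfl
  · rw [Nat.cast_one]
    refine momentSeries_mul_of_convolution (fun q hq j => coeff_momentSeries_one hq j)
      (convolution_of_difference_equation (s := 2) (κ := 1) (w := 2) (by norm_num) ?_ ?_ ?_) hp hq
    · simp [binomialCoeffPoly]
    · intro j
      rw [eval_binomialCoeffPoly, rising_succ_left]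
      simp
    · intro j x
      simp only [eval_binomialCoeffPoly]
      rw [show (x + 2) / 2 = x / 2 + 1 by ring, rising_succ, rising_succ_left, Nat.factorial_succ]
      push_cast
      field_simp
      ring
  · rw [Nat.cast_two]
    refine momentSeries_mul_of_convolution (fun q hq j => coeff_momentSeries_two hq j)
      (convolution_of_difference_equation (s := 1) (κ := 1 / 4) (w := 2) (by norm_num) ?_ ?_ ?_)
      hp hq
    · simp [catalanCoeffPoly]
    · intro j
      rw [eval_catalanCoeffPoly_succ]
      simp
    · intro j x
      cases j with
      | zero =>
        rw [eval_catalanCoeffPoly_succ, eval_catalanCoeffPoly_succ]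
        simp [catalanCoeffPoly]
        ring
      | succ j =>
        simp only [eval_catalanCoeffPoly_succ]
        push_cast
        rw [rising_succ, show x + ((j : ℝ) + 1) + 2 = x + j + 3 by ring, rising_succ_left,
          show x + 1 + ((j : ℝ) + 1) + 2 = x + j + 3 + 1 by ring,
          show x + 2 + (j : ℝ) + 2 = x + j + 3 + 1 by ring, Nat.factorial_succ (j + 1)]
        push_cast
        field_simp
        ring

lemma momentSeries_pow {h : ℕ} (hh : h = 1 ∨ h = 2) {q : ℝ} (hq : 0 < q) (n : ℕ) :
    momentSeries h q ^ (n + 1) = momentSeries h (((n : ℝ) + 1) * q) := by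
  induction n with
  | zero => simp
  | succ n ih =>
    rw [pow_succ, ih, momentSeries_mul hh (by positivity) hq]
    congr 1
    push_cast
    ring

/-! ### Moments of the uniform law on the sphere -/

/-- The coefficients of a real power series converging everywhere are determined by its sum. -/
lemma coeff_eq_of_hasSum {a b : ℕ → ℝ} {f : ℝ → ℝ}
    (ha : ∀ c, HasSum (fun m => a m * c ^ m) (f c))
    (hb : ∀ c, HasSum (fun m => b m * c ^ m) (f c)) : a = b := by
  have key : ∀ a : ℕ → ℝ, (∀ c, HasSum (fun m => a m * c ^ m) (f c)) →
      HasFPowerSeriesOnBall f (FormalMultilinearSeries.ofScalars ℝ a) 0 1 := by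
    intro a ha
    refine ⟨?_, one_pos, ?_⟩
    · have : Filter.Tendsto (fun n => ‖FormalMultilinearSeries.ofScalars ℝ a n‖
          * ((1 : NNReal) : ℝ) ^ n) Filter.atTop (nhds 0) := by
        have := (ha 1).summable.tendsto_atTop_zero.norm
        simpa using this
      exact_mod_cast FormalMultilinearSeries.le_radius_of_tendsto _ this
    · intro y _
      simpa [FormalMultilinearSeries.ofScalars_apply_eq, mul_comm] using ha y
  have := (key a ha).hasFPowerSeriesAt.eq_formalMultilinearSeries (key b hb).hasFPowerSeriesAt
  exact (FormalMultilinearSeries.ofScalars_series_injective ℝ ℝ) this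

section SphereMoments

open scoped RealInnerProductSpace

variable {d : ℕ}

lemma integrable_exp_neg_sq_norm_add (w : EuclideanSpace ℝ (Fin d)) (c : ℝ) :
    Integrable fun v : EuclideanSpace ℝ (Fin d) => Real.exp (-‖v‖ ^ 2 + c * ⟪w, v⟫) := by
  have := (GaussianFourier.integrable_cexp_neg_mul_sq_norm_add (V := EuclideanSpace ℝ (Fin d))
    (b := 1) (by simp) c w).re
  refine this.congr (Filter.Eventually.of_forall fun v => ?_)
  simp only [neg_mul, one_mul]
  rw [show -(‖v‖ : ℂ) ^ 2 + c * ((⟪w, v⟫ : ℝ) : ℂ) = ((-‖v‖ ^ 2 + c * ⟪w, v⟫ : ℝ) : ℂ) by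
    push_cast; rfl, ← Complex.ofReal_exp]
  exact RCLike.ofReal_re _

lemma integral_exp_neg_sq_norm_add (w : EuclideanSpace ℝ (Fin d)) (c : ℝ) :
    ∫ v : EuclideanSpace ℝ (Fin d), Real.exp (-‖v‖ ^ 2 + c * ⟪w, v⟫)
      = Real.pi ^ ((d : ℝ) / 2) * Real.exp (c ^ 2 * ‖w‖ ^ 2 / 4) := by
  have := GaussianFourier.integral_cexp_neg_mul_sq_norm_add (V := EuclideanSpace ℝ (Fin d))
    (b := 1) (by simp) c w
  rw [← Complex.ofReal_inj, ← integral_complex_ofReal]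
  push_cast
  rw [Complex.ofReal_cpow Real.pi_pos.le]
  push_cast
  simpa using this

lemma hasSum_gaussian_moments (w : EuclideanSpace ℝ (Fin d)) (c : ℝ) :
    HasSum (fun m : ℕ => ((∫ v : EuclideanSpace ℝ (Fin d), Real.exp (-‖v‖ ^ 2) * ⟪w, v⟫ ^ m)
      / m.factorial) * c ^ m) (Real.pi ^ ((d : ℝ) / 2) * Real.exp (c ^ 2 * ‖w‖ ^ 2 / 4)) := by
  rw [← integral_exp_neg_sq_norm_add]
  set F : ℕ → EuclideanSpace ℝ (Fin d) → ℝ :=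
    fun m v => Real.exp (-‖v‖ ^ 2) * (c * ⟪w, v⟫) ^ m / m.factorial with hF
  have hFm : ∀ m, Continuous (F m) := fun m => by fun_prop
  -- the partial sums are dominated by `exp(-‖v‖² + |c⟨w,v⟩|)`
  have hdom : Integrable fun v : EuclideanSpace ℝ (Fin d) =>
      Real.exp (-‖v‖ ^ 2) * Real.exp |c * ⟪w, v⟫| := by
    refine ((integrable_exp_neg_sq_norm_add w c).add
      (integrable_exp_neg_sq_norm_add w (-c))).mono' (by fun_prop)
      (Filter.Eventually.of_forall fun v => ?_)
    rw [Real.norm_of_nonneg (by positivity), ← Real.exp_add]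
    simp only [Pi.add_apply]
    rcases abs_cases (c * ⟪w, v⟫) with ⟨h, _⟩ | ⟨h, _⟩
    · rw [h]; exact le_add_of_nonneg_right (by positivity)
    · rw [h, ← neg_mul]; exact le_add_of_nonneg_left (by positivity)
  have hnorm : ∀ v, HasSum (fun m => ‖F m v‖) (Real.exp (-‖v‖ ^ 2) * Real.exp |c * ⟪w, v⟫|) := by
    intro v
    have := (NormedSpace.expSeries_div_hasSum_exp (𝔸 := ℝ) |c * ⟪w, v⟫|).mul_left
      (Real.exp (-‖v‖ ^ 2))
    rw [← Real.exp_eq_exp_ℝ] at this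
    refine this.congr_fun ?_
    intro m
    simp [hF, abs_mul, mul_div_assoc]
  have := hasSum_integral_of_dominated_convergence (μ := volume) (F := F)
    (f := fun v => Real.exp (-‖v‖ ^ 2 + c * ⟪w, v⟫)) (fun m v => ‖F m v‖)
    (fun m => (hFm m).aestronglyMeasurable) (fun m => Filter.Eventually.of_forall fun v => le_rfl)
    (Filter.Eventually.of_forall fun v => (hnorm v).summable)
    (hdom.congr (Filter.Eventually.of_forall fun v => (hnorm v).tsum_eq.symm))
    (Filter.Eventually.of_forall fun v => ?_)
  · refine this.congr_fun ?_
    intro m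
    rw [← integral_div, ← integral_mul_const]
    refine integral_congr_ae (Filter.Eventually.of_forall fun v => ?_)
    simp only [hF, mul_pow]
    ring
  · have := (NormedSpace.expSeries_div_hasSum_exp (𝔸 := ℝ) (c * ⟪w, v⟫)).mul_left
      (Real.exp (-‖v‖ ^ 2))
    rw [← Real.exp_eq_exp_ℝ, ← Real.exp_add] at this
    simpa [hF, mul_div_assoc] using this

lemma gaussian_moment (w : EuclideanSpace ℝ (Fin d)) (m : ℕ) :
    ∫ v : EuclideanSpace ℝ (Fin d), Real.exp (-‖v‖ ^ 2) * ⟪w, v⟫ ^ m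
      = if Even m then Real.pi ^ ((d : ℝ) / 2) * rising (1 / 2) (m / 2) * ‖w‖ ^ m else 0 := by
  set b : ℕ → ℝ := fun m => if Even m then Real.pi ^ ((d : ℝ) / 2) * (‖w‖ ^ 2 / 4) ^ (m / 2)
    / (m / 2).factorial else 0 with hb
  have hbs : ∀ c : ℝ, HasSum (fun m => b m * c ^ m)
      (Real.pi ^ ((d : ℝ) / 2) * Real.exp (c ^ 2 * ‖w‖ ^ 2 / 4)) := by
    intro c
    have h := (NormedSpace.expSeries_div_hasSum_exp (𝔸 := ℝ) (c ^ 2 * ‖w‖ ^ 2 / 4)).mul_left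
      (Real.pi ^ ((d : ℝ) / 2))
    rw [← Real.exp_eq_exp_ℝ] at h
    have hinj : Function.Injective fun j : ℕ => 2 * j := fun i j hij => by simpa using hij
    rw [← hinj.hasSum_iff]
    · refine h.congr_fun ?_
      intro j
      simp only [hb, Function.comp_apply, even_two, Even.mul_right, if_true]
      rw [Nat.mul_div_cancel_left _ two_pos, pow_mul, show c ^ 2 * ‖w‖ ^ 2 / 4
        = c ^ 2 * (‖w‖ ^ 2 / 4) by ring, mul_pow]
      ring
    · intro m hm
      have : ¬ Even m := fun ⟨k, hk⟩ => hm ⟨k, by show 2 * k = m; omega⟩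
      simp [hb, this]
  have := congrFun (coeff_eq_of_hasSum (hasSum_gaussian_moments w) hbs) m
  rw [div_eq_iff (by positivity)] at this
  rw [this]
  simp only [hb]
  split_ifs with hm
  · obtain ⟨j, rfl⟩ := even_iff_exists_two_mul.1 hm
    rw [Nat.mul_div_cancel_left _ two_pos, factorial_two_mul, pow_mul, div_pow]
    field_simp
  · simp

/-- Integration in polar coordinates of a function which is a product of a radial function and a
power of a linear form. -/
lemma integral_radial_mul_inner_pow (hd : 0 < d) (f : ℝ → ℝ) (w : EuclideanSpace ℝ (Fin d))
    (m : ℕ) :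
    ∫ x : EuclideanSpace ℝ (Fin d), f ‖x‖ * ⟪w, x⟫ ^ m
      = (∫ v, ⟪w, (v : EuclideanSpace ℝ (Fin d))⟫ ^ m
          ∂(Measure.toSphere (volume : Measure (EuclideanSpace ℝ (Fin d)))))
        * ∫ r in Set.Ioi (0 : ℝ), r ^ (d - 1 + m) * f r := by
  have : Nonempty (Fin d) := ⟨⟨0, hd⟩⟩
  set μ : Measure (EuclideanSpace ℝ (Fin d)) := volume with hμ
  have hdim : Module.finrank ℝ (EuclideanSpace ℝ (Fin d)) = d := by simp
  calc
    ∫ x, f ‖x‖ * ⟪w, x⟫ ^ m ∂μ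
        = ∫ x : ({(0)}ᶜ : Set (EuclideanSpace ℝ (Fin d))), f ‖x.1‖ * ⟪w, x.1⟫ ^ m
          ∂(μ.comap (↑)) := by
      rw [integral_subtype_comap (measurableSet_singleton _).compl
        fun x => f ‖x‖ * ⟪w, x⟫ ^ m, restrict_compl_singleton]
    _ = ∫ x : Metric.sphere (0 : EuclideanSpace ℝ (Fin d)) 1 × Set.Ioi (0 : ℝ),
          ⟪w, (x.1 : EuclideanSpace ℝ (Fin d))⟫ ^ m * ((x.2 : ℝ) ^ m * f x.2)
          ∂μ.toSphere.prod (.volumeIoiPow (d - 1)) := by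
      rw [show Measure.volumeIoiPow (d - 1) = Measure.volumeIoiPow
          (Module.finrank ℝ (EuclideanSpace ℝ (Fin d)) - 1) by rw [hdim],
        ← μ.measurePreserving_homeomorphUnitSphereProd.integral_comp
        (Homeomorph.measurableEmbedding _)]
      refine integral_congr_ae (Filter.Eventually.of_forall fun x => ?_)
      have hx : ‖x.1‖ ≠ 0 := norm_ne_zero_iff.2 x.2
      simp only [homeomorphUnitSphereProd_apply_snd_coe, homeomorphUnitSphereProd_apply_fst_coe,
        inner_smul_right, mul_pow, inv_pow]
      field_simp
    _ = _ := by
      rw [integral_prod_mul (fun v : Metric.sphere (0 : EuclideanSpace ℝ (Fin d)) 1 =>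
        ⟪w, (v : EuclideanSpace ℝ (Fin d))⟫ ^ m) (fun r : Set.Ioi (0 : ℝ) => (r : ℝ) ^ m * f r)]
      congr 1
      simp only [Measure.volumeIoiPow, ENNReal.ofReal]
      rw [integral_withDensity_eq_integral_smul,
        integral_subtype_comap measurableSet_Ioi
          fun a => Real.toNNReal (a ^ (d - 1)) • (a ^ m * f a),
        setIntegral_congr_fun measurableSet_Ioi fun x hx => ?_]
      · simp only [NNReal.smul_def]
        rw [Real.coe_toNNReal _ (pow_nonneg (Set.mem_Ioi.1 hx).le _), smul_eq_mul, pow_add]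
        ring
      · exact (measurable_subtype_coe.pow_const _).real_toNNReal

lemma integral_pow_mul_exp_neg_sq (k : ℕ) :
    ∫ r in Set.Ioi (0 : ℝ), r ^ k * Real.exp (-r ^ 2) = Real.Gamma (((k : ℝ) + 1) / 2) / 2 := by
  have := integral_rpow_mul_exp_neg_rpow (p := 2) (q := k) two_pos
    (by have := (Nat.cast_nonneg k : (0 : ℝ) ≤ k); linarith)
  simp only [Real.rpow_natCast, Real.rpow_ofNat] at this
  rw [this]
  ring

/-- The moments of the surface measure of the unit sphere: compare the Gaussian integral in
Cartesian and in polar coordinates. -/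
lemma integral_toSphere_inner_pow (hd : 0 < d) (w : EuclideanSpace ℝ (Fin d)) (m : ℕ) :
    ∫ v, ⟪w, (v : EuclideanSpace ℝ (Fin d))⟫ ^ m
          ∂(Measure.toSphere (volume : Measure (EuclideanSpace ℝ (Fin d))))
      = 2 * Real.pi ^ ((d : ℝ) / 2) / Real.Gamma ((d : ℝ) / 2)
          * (sphereMoment ((d : ℝ) / 2) m * ‖w‖ ^ m) := by
  have h := integral_radial_mul_inner_pow hd (fun r => Real.exp (-r ^ 2)) w m
  rw [gaussian_moment, integral_pow_mul_exp_neg_sq] at h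
  have hk : (((d - 1 + m : ℕ) : ℝ) + 1) / 2 = ((d : ℝ) + m) / 2 := by
    rw [Nat.cast_add, Nat.cast_sub hd]
    push_cast
    ring
  rw [hk] at h
  have hd' : (0 : ℝ) < d := by exact_mod_cast hd
  have hG : 0 < Real.Gamma (((d : ℝ) + m) / 2) := Real.Gamma_pos_of_pos (by positivity)
  by_cases hm : Even m
  · obtain ⟨j, rfl⟩ := even_iff_exists_two_mul.1 hm
    rw [if_pos hm, Nat.mul_div_cancel_left _ two_pos] at h
    rw [sphereMoment_two_mul]
    rw [show ((d : ℝ) + (2 * j : ℕ)) / 2 = d / 2 + j by push_cast; ring,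
      Gamma_add_natCast (by positivity)] at h
    have h1 := rising_pos (x := (d : ℝ) / 2) (by positivity) j
    have h2 : 0 < Real.Gamma ((d : ℝ) / 2) := Real.Gamma_pos_of_pos (by positivity)
    field_simp
    field_simp at h
    linarith
  · rw [if_neg hm] at h
    rw [sphereMoment_of_odd _ hm]
    simp only [zero_mul, mul_zero]
    have := mul_eq_zero.1 h.symm
    rcases this with h | h
    · exact h
    · linarith

lemma toSphere_real_univ (hd : 0 < d) :
    (Measure.toSphere (volume : Measure (EuclideanSpace ℝ (Fin d)))).real Set.univ
      = 2 * Real.pi ^ ((d : ℝ) / 2) / Real.Gamma ((d : ℝ) / 2) := by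
  have := integral_toSphere_inner_pow hd 0 0
  simpa [sphereMoment] using this

lemma isProbabilityMeasure_uniformSphere (hd : 0 < d) (r : ℝ) :
    IsProbabilityMeasure (uniformSphere d r) := by
  have : Nonempty (Fin d) := ⟨⟨0, hd⟩⟩
  have h : IsProbabilityMeasure (ProbabilityTheory.cond
      (Measure.toSphere (volume : Measure (EuclideanSpace ℝ (Fin d)))) Set.univ) :=
    cond_isProbabilityMeasure (by
      rw [Measure.measure_univ_ne_zero]
      exact Measure.toSphere_ne_zero _)
  exact Measure.isProbabilityMeasure_map (by fun_prop)

lemma integral_uniformSphere_inner_pow (hd : 0 < d) (w : EuclideanSpace ℝ (Fin d)) (m : ℕ) :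
    ∫ v, ⟪w, v⟫ ^ m ∂(uniformSphere d 1) = sphereMoment ((d : ℝ) / 2) m * ‖w‖ ^ m := by
  rw [uniformSphere, integral_map (by fun_prop) (by fun_prop), ProbabilityTheory.cond,
    Measure.restrict_univ, integral_smul_measure]
  simp only [one_smul]
  rw [integral_toSphere_inner_pow hd, ENNReal.toReal_inv, ← measureReal_def,
    toSphere_real_univ hd, smul_eq_mul, ← mul_assoc, inv_mul_cancel₀, one_mul]
  have hd' : (0 : ℝ) < d := by exact_mod_cast hd
  have h2 : 0 < Real.Gamma ((d : ℝ) / 2) := Real.Gamma_pos_of_pos (by positivity)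
  positivity

lemma ae_uniformSphere_norm {r : ℝ} (hr : 0 ≤ r) :
    ∀ᵐ v ∂(uniformSphere d r), ‖v‖ = r := by
  rw [uniformSphere, ae_map_iff (by fun_prop) (measurableSet_eq_fun (by fun_prop) (by fun_prop))]
  refine Filter.Eventually.of_forall fun v => ?_
  rw [norm_smul, Real.norm_of_nonneg hr, norm_eq_of_mem_sphere, mul_one]

end SphereMoments

/-! ### Beta and Dirichlet integrals -/

lemma integral_beta_scaled {a b t : ℝ} (ha : 0 < a) (hb : 0 < b) (ht : 0 < t) :
    ∫ s in Set.Ioo 0 t, s ^ (a - 1) * (t - s) ^ (b - 1)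
      = t ^ (a + b - 1) * (Real.Gamma a * Real.Gamma b / Real.Gamma (a + b)) := by
  have h := Complex.betaIntegral_scaled a b ht
  rw [Complex.betaIntegral_eq_Gamma_mul_div _ _ (by simpa) (by simpa), ← Complex.ofReal_add,
    Complex.Gamma_ofReal, Complex.Gamma_ofReal, Complex.Gamma_ofReal,
    intervalIntegral.integral_of_le ht.le, integral_Ioc_eq_integral_Ioo] at h
  rw [← Complex.ofReal_inj, ← integral_complex_ofReal]
  push_cast
  rw [Complex.ofReal_cpow ht.le]
  push_cast
  push_cast at h
  rw [← h]
  refine setIntegral_congr_fun measurableSet_Ioo fun s hs => ?_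
  rw [Complex.ofReal_cpow hs.1.le, Complex.ofReal_cpow (sub_nonneg.2 hs.2.le)]
  push_cast
  rfl

lemma integrableOn_beta_scaled {a b t : ℝ} (ha : 0 < a) (hb : 0 < b) (ht : 0 < t) :
    IntegrableOn (fun s : ℝ => s ^ (a - 1) * (t - s) ^ (b - 1)) (Set.Ioo 0 t) := by
  -- a function that is not integrable has Bochner integral `0`
  by_contra h
  have h1 := integral_beta_scaled ha hb ht
  rw [integral_undef h] at h1
  have := Real.Gamma_pos_of_pos ha
  have := Real.Gamma_pos_of_pos hb
  have := Real.Gamma_pos_of_pos (add_pos ha hb)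
  have h2 : 0 < t ^ (a + b - 1) * (Real.Gamma a * Real.Gamma b / Real.Gamma (a + b)) := by
    positivity
  linarith

lemma lintegral_beta_scaled {a b t : ℝ} (ha : 0 < a) (hb : 0 < b) (ht : 0 < t) :
    ∫⁻ s in Set.Ioo 0 t, ENNReal.ofReal (s ^ (a - 1) * (t - s) ^ (b - 1))
      = ENNReal.ofReal (t ^ (a + b - 1) *
          (Real.Gamma a * Real.Gamma b / Real.Gamma (a + b))) := by
  rw [← integral_beta_scaled ha hb ht,
    ofReal_integral_eq_lintegral_ofReal (integrableOn_beta_scaled ha hb ht)]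
  filter_upwards [ae_restrict_mem measurableSet_Ioo] with s hs
  have h1 := hs.1
  have h2 := sub_pos.2 hs.2
  simp only [Pi.zero_apply]
  positivity

lemma measurableSet_timeSimplex (n : ℕ) (t : ℝ) : MeasurableSet (timeSimplex n t) := by
  have : timeSimplex n t = ⋂ k : Fin n, {τ | 0 < τ k} ∩
      {τ | τ k < t - ∑ j ∈ Finset.Iio k, τ j} := by
    ext τ
    simp [timeSimplex]
  rw [this]
  refine MeasurableSet.iInter fun k => ?_
  exact (measurableSet_lt measurable_const (measurable_pi_apply k)).inter
    (measurableSet_lt (measurable_pi_apply k) (by fun_prop))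

lemma sum_Iio_succ_cons {n : ℕ} (s : ℝ) (τ : Fin n → ℝ) (k : Fin n) :
    ∑ j ∈ Finset.Iio k.succ, (Fin.cons s τ : Fin (n + 1) → ℝ) j
      = s + ∑ j ∈ Finset.Iio k, τ j := by
  have h1 : ∀ {m : ℕ} (k : Fin m) (f : Fin m → ℝ),
      ∑ j ∈ Finset.Iio k, f j = ∑ j, if j < k then f j else 0 := by
    intro m k f
    rw [← Finset.sum_filter]
    congr 1
    ext j
    simp
  rw [h1, h1, Fin.sum_univ_succ]
  simp

lemma cons_mem_timeSimplex {n : ℕ} {t s : ℝ} {τ : Fin n → ℝ} :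
    (Fin.cons s τ : Fin (n + 1) → ℝ) ∈ timeSimplex (n + 1) t
      ↔ s ∈ Set.Ioo 0 t ∧ τ ∈ timeSimplex n (t - s) := by
  simp only [timeSimplex, Set.mem_ofPred_eq, Fin.forall_fin_succ, sum_Iio_succ_cons,
    Fin.cons_zero, Fin.cons_succ, Set.mem_Ioo, sub_sub]
  simp [show Finset.Iio (0 : Fin (n + 1)) = ∅ by ext; simp]

lemma sum_lt_of_mem_timeSimplex {n : ℕ} {t : ℝ} (ht : 0 < t) {τ : Fin n → ℝ}
    (hτ : τ ∈ timeSimplex n t) : 0 < t - ∑ j, τ j := by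
  induction n generalizing t with
  | zero => simpa
  | succ n ih =>
    rw [← Fin.cons_self_tail τ, cons_mem_timeSimplex] at hτ
    have := ih (sub_pos.2 hτ.1.2) hτ.2
    rw [Fin.sum_univ_succ]
    simp only [Fin.tail] at this
    linarith

/-- The unnormalised Dirichlet density with parameters `a_1, …, a_{n+1}` on the simplex of total
length `t`. -/
def dirichletWeight (n : ℕ) (t : ℝ) (a : Fin (n + 1) → ℝ) : (Fin n → ℝ) → ℝ :=
  (timeSimplex n t).indicator fun τ =>
    (∏ k : Fin n, τ k ^ (a k.castSucc - 1)) * (t - ∑ j, τ j) ^ (a (Fin.last n) - 1)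

lemma measurable_dirichletWeight (n : ℕ) (t : ℝ) (a : Fin (n + 1) → ℝ) :
    Measurable (dirichletWeight n t a) := by
  refine Measurable.indicator ?_ (measurableSet_timeSimplex n t)
  fun_prop

lemma dirichletWeight_nonneg {n : ℕ} {t : ℝ} (ht : 0 < t) (a : Fin (n + 1) → ℝ) (τ : Fin n → ℝ) :
    0 ≤ dirichletWeight n t a τ := by
  refine Set.indicator_nonneg (fun τ hτ => ?_) τ
  have h1 := sum_lt_of_mem_timeSimplex ht hτ
  refine mul_nonneg (Finset.prod_nonneg fun k _ => ?_) (by positivity)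
  have := (hτ k).1
  positivity

lemma dirichletWeight_cons {n : ℕ} {t s : ℝ} (a : Fin (n + 2) → ℝ) (τ : Fin n → ℝ) :
    dirichletWeight (n + 1) t a (Fin.cons s τ)
      = (Set.Ioo 0 t).indicator (fun s => s ^ (a 0 - 1)
          * dirichletWeight n (t - s) (Fin.tail a) τ) s := by
  by_cases hs : s ∈ Set.Ioo 0 t
  · rw [Set.indicator_of_mem hs]
    by_cases hτ : τ ∈ timeSimplex n (t - s)
    · rw [dirichletWeight, dirichletWeight, Set.indicator_of_mem (cons_mem_timeSimplex.2 ⟨hs, hτ⟩),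
        Set.indicator_of_mem hτ, Fin.prod_univ_succ, Fin.sum_univ_succ]
      simp only [Fin.cons_zero, Fin.cons_succ, Fin.tail, Fin.castSucc_zero, Fin.succ_castSucc,
        Fin.succ_last, sub_sub]
      ring
    · rw [dirichletWeight, dirichletWeight,
        Set.indicator_of_notMem fun h => hτ (cons_mem_timeSimplex.1 h).2,
        Set.indicator_of_notMem hτ, mul_zero]
  · rw [Set.indicator_of_notMem hs, dirichletWeight,
      Set.indicator_of_notMem fun h => hs (cons_mem_timeSimplex.1 h).1]

/-- The Dirichlet integral, by integrating out the first coordinate of the simplex. -/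
lemma lintegral_dirichletWeight (n : ℕ) {t : ℝ} (ht : 0 < t) {a : Fin (n + 1) → ℝ}
    (ha : ∀ k, 0 < a k) :
    ∫⁻ τ, ENNReal.ofReal (dirichletWeight n t a τ)
      = ENNReal.ofReal (t ^ (∑ k, a k - 1)
          * ((∏ k, Real.Gamma (a k)) / Real.Gamma (∑ k, a k))) := by
  induction n generalizing t with
  | zero =>
    have hG : Real.Gamma (a 0) ≠ 0 := (Real.Gamma_pos_of_pos (ha 0)).ne'
    have h1 : ∀ τ : Fin 0 → ℝ, dirichletWeight 0 t a τ = t ^ (a 0 - 1) := by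
      intro τ
      rw [dirichletWeight, Set.indicator_of_mem (fun k => k.elim0)]
      simp
    simp [h1, hG, volume_pi, Measure.pi_empty_univ]
  | succ n ih =>
    have hS : 0 < ∑ k, Fin.tail a k := Finset.sum_pos (fun k _ => ha _) Finset.univ_nonempty
    have hmp := (volume_preserving_piFinSuccAbove (fun _ : Fin (n + 1) => ℝ) 0).symm
    rw [← hmp.lintegral_comp (measurable_dirichletWeight _ _ _).ennreal_ofReal,
      Measure.volume_eq_prod, lintegral_prod]
    · have h1 : ∀ (s : ℝ) (τ : Fin n → ℝ), (MeasurableEquiv.piFinSuccAbove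
          (fun _ : Fin (n + 1) => ℝ) 0).symm (s, τ) = (Fin.cons s τ : Fin (n + 1) → ℝ) := by
        intro s τ
        simp [MeasurableEquiv.piFinSuccAbove, Fin.insertNthEquiv]
      have h2 : ∀ s : ℝ, ∫⁻ τ : Fin n → ℝ, ENNReal.ofReal (dirichletWeight (n + 1) t a
          ((MeasurableEquiv.piFinSuccAbove (fun _ : Fin (n + 1) => ℝ) 0).symm (s, τ)))
          = (Set.Ioo 0 t).indicator (fun s => ENNReal.ofReal ((∏ k, Real.Gamma (Fin.tail a k))
              / Real.Gamma (∑ k, Fin.tail a k)) * ENNReal.ofReal (s ^ (a 0 - 1)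
              * (t - s) ^ (∑ k, Fin.tail a k - 1))) s := by
        intro s
        simp only [h1, dirichletWeight_cons]
        by_cases hs : s ∈ Set.Ioo 0 t
        · simp only [Set.indicator_of_mem hs]
          have hs0 : 0 ≤ s ^ (a 0 - 1) := Real.rpow_nonneg hs.1.le _
          simp only [ENNReal.ofReal_mul hs0]
          rw [lintegral_const_mul _ (measurable_dirichletWeight _ _ _).ennreal_ofReal,
            ih (sub_pos.2 hs.2) (a := Fin.tail a) fun k => ha _,
            ENNReal.ofReal_mul (Real.rpow_nonneg (sub_nonneg.2 hs.2.le) _)]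
          ring
        · simp [Set.indicator_of_notMem hs]
      simp only [h2]
      rw [lintegral_indicator measurableSet_Ioo, lintegral_const_mul _ (by fun_prop),
        lintegral_beta_scaled (ha 0) hS ht, ← ENNReal.ofReal_mul, Fin.sum_univ_succ a,
        Fin.prod_univ_succ fun k => Real.Gamma (a k)]
      · congr 1
        have hG : Real.Gamma (∑ k, Fin.tail a k) ≠ 0 := (Real.Gamma_pos_of_pos hS).ne'
        simp only [Fin.tail] at hG ⊢
        field_simp
      · refine div_nonneg (Finset.prod_nonneg fun k _ => ?_) (Real.Gamma_pos_of_pos hS).le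
        exact (Real.Gamma_pos_of_pos (ha _)).le
    · exact ((measurable_dirichletWeight _ _ _).ennreal_ofReal.comp
        (MeasurableEquiv.measurable _)).aemeasurable

/-- All `n + 1` durations `(τ_1, …, τ_n, t - ∑ τ_j)`. -/
def durations {n : ℕ} (t : ℝ) (τ : Fin n → ℝ) : Fin (n + 1) → ℝ :=
  Fin.snoc (α := fun _ => ℝ) τ (t - ∑ j, τ j)

lemma measurable_durations {n : ℕ} (t : ℝ) : Measurable (durations (n := n) t) := by
  refine measurable_pi_iff.2 fun k => ?_
  refine Fin.lastCases ?_ (fun k => ?_) k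
  · simp only [durations, Fin.snoc_last]
    fun_prop
  · simp only [durations, Fin.snoc_castSucc]
    fun_prop

lemma durations_pos {n : ℕ} {t : ℝ} (ht : 0 < t) {τ : Fin n → ℝ} (hτ : τ ∈ timeSimplex n t)
    (k : Fin (n + 1)) : 0 < durations t τ k := by
  refine Fin.lastCases ?_ (fun k => ?_) k
  · simpa only [durations, Fin.snoc_last] using sum_lt_of_mem_timeSimplex ht hτ
  · simpa only [durations, Fin.snoc_castSucc] using (hτ k).1

lemma sum_durations {n : ℕ} (t : ℝ) (τ : Fin n → ℝ) : ∑ k, durations t τ k = t := by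
  simp [Fin.sum_univ_castSucc, durations]

lemma dirichletDensity_eq (q : ℝ) (n : ℕ) (t : ℝ) (τ : Fin n → ℝ) :
    dirichletDensity q n t τ = Real.Gamma (((n : ℝ) + 1) * q) / Real.Gamma q ^ (n + 1)
      * (1 / t ^ (((n : ℝ) + 1) * q - 1)) * dirichletWeight n t (fun _ => q) τ := by
  by_cases hτ : τ ∈ timeSimplex n t
  · simp [dirichletDensity, dirichletWeight, hτ]
  · simp [dirichletDensity, dirichletWeight, hτ]

lemma measurable_dirichletDensity (q : ℝ) (n : ℕ) (t : ℝ) :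
    Measurable (dirichletDensity q n t) := by
  have := (measurable_dirichletWeight n t fun _ => q).const_mul
    (Real.Gamma (((n : ℝ) + 1) * q) / Real.Gamma q ^ (n + 1)
      * (1 / t ^ (((n : ℝ) + 1) * q - 1)))
  simpa only [← dirichletDensity_eq] using this

lemma dirichletDensity_nonneg {q : ℝ} (hq : 0 < q) (n : ℕ) {t : ℝ} (ht : 0 < t)
    (τ : Fin n → ℝ) : 0 ≤ dirichletDensity q n t τ := by
  rw [dirichletDensity_eq]
  have h1 := dirichletWeight_nonneg ht (fun _ : Fin (n + 1) => q) τ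
  have h2 := Real.Gamma_pos_of_pos hq
  have h3 : 0 < Real.Gamma (((n : ℝ) + 1) * q) := Real.Gamma_pos_of_pos (by positivity)
  positivity

lemma ae_dirichletLaw_mem (q : ℝ) (n : ℕ) (t : ℝ) :
    ∀ᵐ τ ∂(dirichletLaw q n t), τ ∈ timeSimplex n t := by
  rw [dirichletLaw, ae_withDensity_iff (measurable_dirichletDensity q n t).ennreal_ofReal]
  refine Filter.Eventually.of_forall fun τ h => ?_
  by_contra hτ
  simp [dirichletDensity, hτ] at h

lemma integral_dirichletWeight (n : ℕ) {t : ℝ} (ht : 0 < t) {a : Fin (n + 1) → ℝ}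
    (ha : ∀ k, 0 < a k) :
    ∫ τ, dirichletWeight n t a τ
      = t ^ (∑ k, a k - 1) * ((∏ k, Real.Gamma (a k)) / Real.Gamma (∑ k, a k)) := by
  rw [integral_eq_lintegral_of_nonneg_ae (Filter.Eventually.of_forall
    (dirichletWeight_nonneg ht a)) (measurable_dirichletWeight n t a).aestronglyMeasurable,
    lintegral_dirichletWeight n ht ha, ENNReal.toReal_ofReal]
  have hS : 0 < ∑ k, a k := Finset.sum_pos (fun k _ => ha _) Finset.univ_nonempty
  refine mul_nonneg (by positivity) (div_nonneg (Finset.prod_nonneg fun k _ => ?_)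
    (Real.Gamma_pos_of_pos hS).le)
  exact (Real.Gamma_pos_of_pos (ha _)).le

/-- The mixed moments of the symmetric Dirichlet law. -/
lemma integral_dirichletLaw_prod_pow {q : ℝ} (hq : 0 < q) (n : ℕ) {t : ℝ} (ht : 0 < t)
    (m : Fin (n + 1) → ℕ) :
    ∫ τ, ∏ k, durations t τ k ^ m k ∂(dirichletLaw q n t)
      = t ^ (∑ k, m k) * (∏ k, rising q (m k)) / rising (((n : ℝ) + 1) * q) (∑ k, m k) := by
  rw [dirichletLaw, integral_withDensity_eq_integral_toReal_smul
    (measurable_dirichletDensity q n t).ennreal_ofReal (Filter.Eventually.of_forall fun _ =>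
      ENNReal.ofReal_lt_top)]
  have h1 : ∀ τ : Fin n → ℝ, (ENNReal.ofReal (dirichletDensity q n t τ)).toReal
        • ∏ k, durations t τ k ^ m k
      = Real.Gamma (((n : ℝ) + 1) * q) / Real.Gamma q ^ (n + 1)
      * (1 / t ^ (((n : ℝ) + 1) * q - 1)) * dirichletWeight n t (fun k => q + m k) τ := by
    intro τ
    rw [ENNReal.toReal_ofReal (dirichletDensity_nonneg hq n ht τ), dirichletDensity_eq, smul_eq_mul,
      mul_assoc]
    congr 1
    by_cases hτ : τ ∈ timeSimplex n t
    · rw [dirichletWeight, dirichletWeight, Set.indicator_of_mem hτ, Set.indicator_of_mem hτ,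
        Fin.prod_univ_castSucc]
      have hpos := durations_pos ht hτ
      have e1 : ∀ k : Fin n, durations t τ k.castSucc = τ k := fun k => by simp [durations]
      have e2 : durations t τ (Fin.last n) = t - ∑ j, τ j := by simp [durations]
      have key : ∀ k : Fin (n + 1), durations t τ k ^ (q + m k - 1)
          = durations t τ k ^ (q - 1) * durations t τ k ^ m k := by
        intro k
        rw [← Real.rpow_natCast, ← Real.rpow_add (hpos k)]
        congr 1
        ring
      have h3 := key (Fin.last n)
      rw [e2] at h3
      rw [h3]
      have h4 : ∏ k : Fin n, τ k ^ (q + m k.castSucc - 1)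
          = (∏ k : Fin n, τ k ^ (q - 1)) * ∏ k : Fin n, τ k ^ m k.castSucc := by
        rw [← Finset.prod_mul_distrib]
        refine Finset.prod_congr rfl fun k _ => ?_
        have := key k.castSucc
        rwa [e1] at this
      rw [h4]
      simp only [e1, e2]
      ring
    · simp [dirichletWeight, hτ]
  simp only [h1]
  rw [integral_const_mul, integral_dirichletWeight n ht (fun k => by positivity),
    Finset.sum_add_distrib]
  simp only [Finset.sum_const, Finset.card_univ, Fintype.card_fin, nsmul_eq_mul,
    Gamma_add_natCast hq, Finset.prod_mul_distrib, Finset.prod_const]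
  push_cast
  rw [← Nat.cast_sum, Gamma_add_natCast (by positivity : 0 < ((n : ℝ) + 1) * q)]
  have h2 := Real.Gamma_pos_of_pos hq
  have h3 : 0 < Real.Gamma (((n : ℝ) + 1) * q) := Real.Gamma_pos_of_pos (by positivity)
  have h4 := rising_pos (x := ((n : ℝ) + 1) * q) (by positivity) (∑ k, m k)
  rw [show ((n : ℝ) + 1) * q + ((∑ k, m k : ℕ) : ℝ) - 1
    = (((n : ℝ) + 1) * q - 1) + ((∑ k, m k : ℕ) : ℝ) by ring, Real.rpow_add ht,
    Real.rpow_natCast]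
  have h5 : 0 < t ^ (((n : ℝ) + 1) * q - 1) := by positivity
  field_simp

lemma isProbabilityMeasure_dirichletLaw {q : ℝ} (hq : 0 < q) (n : ℕ) {t : ℝ} (ht : 0 < t) :
    IsProbabilityMeasure (dirichletLaw q n t) := by
  have h := integral_dirichletLaw_prod_pow hq n ht fun _ => 0
  simp only [pow_zero, Finset.prod_const_one, Finset.sum_const_zero, rising_zero, mul_one,
    div_one, integral_const, smul_eq_mul, measureReal_def] at h
  exact ⟨(ENNReal.toReal_eq_one_iff _).1 h⟩

/-! ### The conditional law of the free flight -/

section FreeFlight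

open scoped RealInnerProductSpace

variable {d : ℕ}

lemma hasSum_charFun_of_bounded {μ : Measure (EuclideanSpace ℝ (Fin d))} [IsFiniteMeasure μ]
    {a : ℝ} (hμ : ∀ᵐ x ∂μ, ‖x‖ ≤ a) (w : EuclideanSpace ℝ (Fin d)) :
    HasSum (fun m : ℕ => (Complex.I ^ m / m.factorial) * ((∫ x, ⟪w, x⟫ ^ m ∂μ : ℝ) : ℂ))
      (charFun μ w) := by
  rw [charFun_apply]
  set F : ℕ → EuclideanSpace ℝ (Fin d) → ℂ :=
    fun m x => (Complex.I ^ m / m.factorial) * ((⟪w, x⟫ ^ m : ℝ) : ℂ) with hF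
  have hFm : ∀ m, Continuous (F m) := fun m => by fun_prop
  have := hasSum_integral_of_dominated_convergence (μ := μ) (F := F)
    (f := fun x => Complex.exp (⟪x, w⟫ * Complex.I))
    (fun m _ => (‖w‖ * a) ^ m / m.factorial)
    (fun m => (hFm m).aestronglyMeasurable) (fun m => ?_)
    (Filter.Eventually.of_forall fun v => Real.summable_pow_div_factorial _)
    (integrable_const _) (Filter.Eventually.of_forall fun x => ?_)
  · refine this.congr_fun fun m => ?_
    rw [hF, integral_const_mul, integral_complex_ofReal]
  · filter_upwards [hμ] with x hx
    simp only [hF, norm_mul, norm_div, norm_pow, Complex.norm_I, one_pow, Complex.norm_natCast,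
      Complex.norm_real]
    rw [one_div, inv_mul_eq_div]
    gcongr
    exact (abs_real_inner_le_norm w x).trans (by gcongr)
  · have := NormedSpace.expSeries_div_hasSum_exp (𝔸 := ℂ) (⟪x, w⟫ * Complex.I)
    rw [← Complex.exp_eq_exp_ℂ] at this
    refine this.congr_fun fun m => ?_
    simp only [hF, real_inner_comm, mul_pow]
    push_cast
    ring

/-- Laws of bounded random vectors are determined by the moments of their linear forms. -/
lemma ext_of_inner_moments {μ ν : Measure (EuclideanSpace ℝ (Fin d))} [IsFiniteMeasure μ]
    [IsFiniteMeasure ν] {a : ℝ} (hμ : ∀ᵐ x ∂μ, ‖x‖ ≤ a) (hν : ∀ᵐ x ∂ν, ‖x‖ ≤ a)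
    (h : ∀ w m, ∫ x, ⟪w, x⟫ ^ m ∂μ = ∫ x, ⟪w, x⟫ ^ m ∂ν) : μ = ν := by
  refine Measure.ext_of_charFun (funext fun w => ?_)
  have h1 := hasSum_charFun_of_bounded hμ w
  simp only [h] at h1
  exact h1.unique (hasSum_charFun_of_bounded hν w)

/-- The radial profile of the law on the ball of radius `a` of `ℝ^d` with density proportional to
`(a² - ‖x‖²)^(κ - 1)`. If `2 κ` is a positive integer, this is the law of the projection to
`ℝ^d` of a uniform vector of the sphere of radius `a` of `ℝ^(d + 2 κ)`. -/
def ballProfile (d : ℕ) (κ a r : ℝ) : ℝ :=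
  (Set.Iio a).indicator (fun r => Real.Gamma ((d : ℝ) / 2 + κ) / Real.Gamma κ
    / (Real.pi ^ ((d : ℝ) / 2) * a ^ ((d : ℝ) + 2 * κ - 2)) * (a ^ 2 - r ^ 2) ^ (κ - 1)) r

lemma measurable_ballProfile (d : ℕ) (κ a : ℝ) : Measurable (ballProfile d κ a) :=
  Measurable.indicator (by fun_prop) measurableSet_Iio

lemma measurable_ballProfile_norm (d : ℕ) (κ a : ℝ) :
    Measurable fun x : EuclideanSpace ℝ (Fin d) => ENNReal.ofReal (ballProfile d κ a ‖x‖) :=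
  ((measurable_ballProfile d κ a).comp measurable_norm).ennreal_ofReal

lemma ballProfile_nonneg {κ a r : ℝ} (hκ : 0 < κ) (ha : 0 < a) (hr : 0 ≤ r) :
    0 ≤ ballProfile d κ a r := by
  rw [ballProfile]
  by_cases h : r ∈ Set.Iio a
  · rw [Set.indicator_of_mem h]
    have h1 : 0 < a ^ 2 - r ^ 2 := by
      have := Set.mem_Iio.1 h
      nlinarith
    have h2 := Real.Gamma_pos_of_pos hκ
    have h3 : 0 < Real.Gamma ((d : ℝ) / 2 + κ) := Real.Gamma_pos_of_pos (by positivity)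
    positivity
  · rw [Set.indicator_of_notMem h]

/-- The substitution `s = r²` turns the radial integrals of `ballProfile` into Beta integrals. -/
lemma integral_pow_mul_ballProfile {κ a : ℝ} (hκ : 0 < κ) (ha : 0 < a) (k : ℕ) :
    ∫ r in Set.Ioi (0 : ℝ), r ^ k * ballProfile d κ a r
      = Real.Gamma ((d : ℝ) / 2 + κ) / Real.Gamma κ
          / (Real.pi ^ ((d : ℝ) / 2) * a ^ ((d : ℝ) + 2 * κ - 2))
        * (a ^ ((k : ℝ) + 1 + 2 * κ - 2) / 2 * (Real.Gamma (((k : ℝ) + 1) / 2) * Real.Gamma κ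
          / Real.Gamma (((k : ℝ) + 1) / 2 + κ))) := by
  set C := Real.Gamma ((d : ℝ) / 2 + κ) / Real.Gamma κ
          / (Real.pi ^ ((d : ℝ) / 2) * a ^ ((d : ℝ) + 2 * κ - 2)) with hC
  set g : ℝ → ℝ := (Set.Ioo 0 (a ^ 2)).indicator
    fun s => s ^ (((k : ℝ) + 1) / 2 - 1) * (a ^ 2 - s) ^ (κ - 1) with hg
  have h1 := integral_comp_rpow_Ioi_of_pos (g := g) two_pos
  have h2 : ∫ y in Set.Ioi (0 : ℝ), g y
      = (a ^ 2) ^ (((k : ℝ) + 1) / 2 + κ - 1) * (Real.Gamma (((k : ℝ) + 1) / 2) * Real.Gamma κ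
          / Real.Gamma (((k : ℝ) + 1) / 2 + κ)) := by
    rw [hg, setIntegral_indicator measurableSet_Ioo,
      Set.inter_eq_right.2 (fun x hx => hx.1),
      integral_beta_scaled (by positivity) hκ (by positivity)]
  have h3 : ∀ r ∈ Set.Ioi (0 : ℝ), r ^ k * ballProfile d κ a r
      = C / 2 * ((2 * r ^ ((2 : ℝ) - 1)) • g (r ^ (2 : ℝ))) := by
    intro r hr
    have hr : 0 < r := hr
    rw [hg, ballProfile, Real.rpow_ofNat]
    by_cases hra : r < a
    · have hra2 : r ^ 2 ∈ Set.Ioo 0 (a ^ 2) := ⟨by positivity, by gcongr⟩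
      rw [Set.indicator_of_mem (Set.mem_Iio.2 hra), Set.indicator_of_mem hra2]
      have : (r ^ 2) ^ (((k : ℝ) + 1) / 2 - 1) * r = r ^ k := by
        rw [← Real.rpow_natCast r 2, ← Real.rpow_mul hr.le]
        nth_rewrite 2 [← Real.rpow_one r]
        rw [← Real.rpow_add hr, ← Real.rpow_natCast r k]
        congr 1
        push_cast
        ring
      rw [← this, ← hC]
      norm_num
      ring
    · have hra2 : r ^ 2 ∉ Set.Ioo 0 (a ^ 2) := by
        intro h
        exact hra (lt_of_pow_lt_pow_left₀ 2 ha.le h.2)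
      rw [Set.indicator_of_notMem (by simpa using hra), Set.indicator_of_notMem hra2]
      simp
  rw [setIntegral_congr_fun measurableSet_Ioi h3, integral_const_mul, h1, h2,
    ← Real.rpow_natCast a 2, ← Real.rpow_mul ha.le]
  rw [show ((2 : ℕ) : ℝ) * (((k : ℝ) + 1) / 2 + κ - 1) = (k : ℝ) + 1 + 2 * κ - 2 by
    push_cast; ring]
  ring

lemma integral_ballProfile_mul_inner_pow (hd : 0 < d) {κ a : ℝ} (hκ : 0 < κ) (ha : 0 < a)
    (w : EuclideanSpace ℝ (Fin d)) (m : ℕ) :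
    ∫ x : EuclideanSpace ℝ (Fin d), ballProfile d κ a ‖x‖ * ⟪w, x⟫ ^ m
      = sphereMoment ((d : ℝ) / 2 + κ) m * (a * ‖w‖) ^ m := by
  rw [integral_radial_mul_inner_pow hd, integral_toSphere_inner_pow hd,
    integral_pow_mul_ballProfile hκ ha]
  by_cases hm : Even m
  · obtain ⟨j, rfl⟩ := even_iff_exists_two_mul.1 hm
    have hd' : (0 : ℝ) < d := by exact_mod_cast hd
    have hk : ((d - 1 + 2 * j : ℕ) : ℝ) + 1 = d + 2 * j := by
      rw [Nat.cast_add, Nat.cast_sub hd]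
      push_cast
      ring
    have h1 := Real.Gamma_pos_of_pos hκ
    have h2 : 0 < Real.Gamma ((d : ℝ) / 2) := Real.Gamma_pos_of_pos (by positivity)
    have h3 : 0 < Real.Gamma ((d : ℝ) / 2 + κ) := Real.Gamma_pos_of_pos (by positivity)
    have h4 := rising_pos (x := (d : ℝ) / 2) (by positivity) j
    have h5 := rising_pos (x := (d : ℝ) / 2 + κ) (by positivity) j
    rw [hk, sphereMoment_two_mul, sphereMoment_two_mul, show ((d : ℝ) + 2 * j) / 2 = d / 2 + j by
      ring, Gamma_add_natCast (by positivity), show (d : ℝ) / 2 + j + κ = d / 2 + κ + j by ring,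
      Gamma_add_natCast (by positivity), show (d : ℝ) + 2 * j + 2 * κ - 2
      = (d + 2 * κ - 2) + (2 * j : ℕ) by push_cast; ring, Real.rpow_add ha, Real.rpow_natCast,
      mul_pow]
    have h6 : 0 < a ^ ((d : ℝ) + 2 * κ - 2) := by positivity
    have h7 : 0 < Real.pi ^ ((d : ℝ) / 2) := by positivity
    field_simp
  · simp [sphereMoment_of_odd _ hm]

/-- The law with radial density `ballProfile`. -/
def ballLaw (d : ℕ) (κ a : ℝ) : Measure (EuclideanSpace ℝ (Fin d)) :=
  volume.withDensity fun x => ENNReal.ofReal (ballProfile d κ a ‖x‖)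

lemma integral_ballLaw_inner_pow (hd : 0 < d) {κ a : ℝ} (hκ : 0 < κ) (ha : 0 < a)
    (w : EuclideanSpace ℝ (Fin d)) (m : ℕ) :
    ∫ x, ⟪w, x⟫ ^ m ∂(ballLaw d κ a) = sphereMoment ((d : ℝ) / 2 + κ) m * (a * ‖w‖) ^ m := by
  rw [ballLaw, integral_withDensity_eq_integral_toReal_smul
    (measurable_ballProfile_norm d κ a)
    (Filter.Eventually.of_forall fun _ => ENNReal.ofReal_lt_top),
    ← integral_ballProfile_mul_inner_pow hd hκ ha]
  refine integral_congr_ae (Filter.Eventually.of_forall fun x => ?_)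
  simp only [smul_eq_mul]
  rw [ENNReal.toReal_ofReal (ballProfile_nonneg hκ ha (norm_nonneg x))]

lemma isProbabilityMeasure_ballLaw (hd : 0 < d) {κ a : ℝ} (hκ : 0 < κ) (ha : 0 < a) :
    IsProbabilityMeasure (ballLaw d κ a) := by
  have h := integral_ballLaw_inner_pow hd hκ ha 0 0
  simp only [pow_zero, integral_const, smul_eq_mul, mul_one, measureReal_def, sphereMoment,
    Even.zero, if_true, Nat.zero_div, rising_zero, div_one] at h
  exact ⟨(ENNReal.toReal_eq_one_iff _).1 h⟩

lemma ae_ballLaw_norm_lt (κ a : ℝ) : ∀ᵐ x ∂(ballLaw d κ a), ‖x‖ < a := by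
  rw [ballLaw, ae_withDensity_iff
    (measurable_ballProfile_norm d κ a)]
  refine Filter.Eventually.of_forall fun x h => ?_
  by_contra hx
  refine h ?_
  rw [ballProfile, Set.indicator_of_notMem (by simpa using hx), ENNReal.ofReal_zero]

/-- The position `c ∑ τ_k v_k` reached at time `t`, as a function of the durations and of the
directions. -/
def flightMap (n : ℕ) (c t : ℝ) (p : (Fin n → ℝ) × (Fin (n + 1) → EuclideanSpace ℝ (Fin d))) :
    EuclideanSpace ℝ (Fin d) :=
  c • ∑ k, durations t p.1 k • p.2 k

lemma measurable_flightMap (n : ℕ) (c t : ℝ) : Measurable (flightMap (d := d) n c t) := by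
  have h : ∀ k, Measurable fun p : (Fin n → ℝ) × (Fin (n + 1) → EuclideanSpace ℝ (Fin d)) =>
      durations t p.1 k := fun k =>
    (measurable_pi_apply k).comp ((measurable_durations t).comp measurable_fst)
  have h' : ∀ k, Measurable fun p : (Fin n → ℝ) × (Fin (n + 1) → EuclideanSpace ℝ (Fin d)) =>
      p.2 k := fun k => (measurable_pi_apply k).comp measurable_snd
  exact (Finset.measurable_sum _ fun k _ => (h k).smul (h' k)).const_smul c

lemma integrable_dirichletLaw_prod_pow {q : ℝ} (hq : 0 < q) (n : ℕ) {t : ℝ} (ht : 0 < t)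
    (m : Fin (n + 1) → ℕ) :
    Integrable (fun τ => ∏ k, durations t τ k ^ m k) (dirichletLaw q n t) := by
  -- a function that is not integrable has Bochner integral `0`
  by_contra h
  have h1 := integral_dirichletLaw_prod_pow hq n ht m
  rw [integral_undef h] at h1
  have h2 := rising_pos (x := ((n : ℝ) + 1) * q) (by positivity) (∑ k, m k)
  have h3 : 0 < ∏ k, rising q (m k) := Finset.prod_pos fun k _ => rising_pos hq _
  have : 0 < t ^ (∑ k, m k) * (∏ k, rising q (m k)) / rising (((n : ℝ) + 1) * q) (∑ k, m k) := by
    positivity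
  linarith

lemma coeff_pow_eq_sum_piAntidiag (φ : PowerSeries ℝ) (n m : ℕ) :
    PowerSeries.coeff m (φ ^ n)
      = ∑ p ∈ Finset.piAntidiag (Finset.univ : Finset (Fin n)) m,
          ∏ i, PowerSeries.coeff (p i) φ := by
  have h : φ ^ n = ∏ _i : Fin n, φ := by simp
  rw [h, PowerSeries.coeff_prod]
  refine Finset.sum_equiv Finsupp.equivFunOnFinite (fun l => ?_) (fun l _ => rfl)
  simp [Finset.mem_finsuppAntidiag, Finset.mem_piAntidiag]

/-- Moments of the flight with `n` deviations: expanding the `m`-th power and integrating out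
durations and directions gives the `m`-th coefficient of the `(n + 1)`-st power of the moment
series. -/
lemma integral_flightMap_inner_pow (hd : 0 < d) {h : ℕ} (hh : h = 1 ∨ h = 2) {q : ℝ} (hq : 0 < q)
    (hdq : (h : ℝ) * (q + 1) = d) (n : ℕ) {c t : ℝ} (ht : 0 < t)
    (w : EuclideanSpace ℝ (Fin d)) (m : ℕ) :
    ∫ p, ⟪w, flightMap n c t p⟫ ^ m
        ∂((dirichletLaw q n t).prod (Measure.pi fun _ : Fin (n + 1) => uniformSphere d 1))
      = sphereMoment ((h : ℝ) * (((n : ℝ) + 1) * q + 1) / 2) m * (c * t * ‖w‖) ^ m := by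
  have := isProbabilityMeasure_uniformSphere hd 1
  have := isProbabilityMeasure_dirichletLaw hq n ht
  have hexp : ∀ p : (Fin n → ℝ) × (Fin (n + 1) → EuclideanSpace ℝ (Fin d)),
      ⟪w, flightMap n c t p⟫ ^ m
      = ∑ l ∈ Finset.piAntidiag (Finset.univ : Finset (Fin (n + 1))) m,
        c ^ m * (Nat.multinomial Finset.univ l : ℝ) *
          ((∏ k, durations t p.1 k ^ l k) * ∏ k, ⟪w, p.2 k⟫ ^ l k) := by
    intro p
    rw [flightMap, inner_smul_right, inner_sum, mul_pow, Finset.sum_pow_eq_sum_piAntidiag,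
      Finset.mul_sum]
    refine Finset.sum_congr rfl fun l _ => ?_
    simp only [inner_smul_right, mul_pow, Finset.prod_mul_distrib]
    ring
  have hint : ∀ k : ℕ, Integrable (fun v => ⟪w, v⟫ ^ k) (uniformSphere d 1) := by
    intro k
    refine Integrable.of_bound (by fun_prop) (‖w‖ ^ k) ?_
    filter_upwards [ae_uniformSphere_norm (d := d) zero_le_one] with v hv
    rw [norm_pow]
    gcongr
    simpa [hv] using norm_inner_le_norm (𝕜 := ℝ) w v
  simp only [hexp]
  rw [integral_finsetSum]
  · have hterm : ∀ l ∈ Finset.piAntidiag (Finset.univ : Finset (Fin (n + 1))) m,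
        ∫ p : (Fin n → ℝ) × (Fin (n + 1) → EuclideanSpace ℝ (Fin d)),
          c ^ m * (Nat.multinomial Finset.univ l : ℝ) *
          ((∏ k, durations t p.1 k ^ l k) * ∏ k, ⟪w, p.2 k⟫ ^ l k)
          ∂((dirichletLaw q n t).prod (Measure.pi fun _ : Fin (n + 1) => uniformSphere d 1))
        = (c * t * ‖w‖) ^ m * m.factorial / rising (((n : ℝ) + 1) * q) m
          * ∏ k, PowerSeries.coeff (l k) (momentSeries h q) := by
      intro l hl
      have hlm : ∑ k, l k = m := (Finset.mem_piAntidiag.1 hl).1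
      rw [integral_const_mul, integral_prod_mul (fun τ => ∏ k, durations t τ k ^ l k)
        (fun v : Fin (n + 1) → EuclideanSpace ℝ (Fin d) => ∏ k, ⟪w, v k⟫ ^ l k),
        integral_dirichletLaw_prod_pow hq n ht,
        integral_fintype_prod_eq_prod (fun k v => ⟪w, v⟫ ^ l k)]
      simp only [integral_uniformSphere_inner_pow hd, coeff_momentSeries, hdq]
      have hmul := Nat.multinomial_spec Finset.univ l
      rw [hlm] at hmul
      have hmul' : (m.factorial : ℝ) = (∏ k, ((l k).factorial : ℝ))
          * (Nat.multinomial Finset.univ l : ℝ) := by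
        exact_mod_cast hmul.symm
      have hfac : ∏ k, ((l k).factorial : ℝ) ≠ 0 :=
        Finset.prod_ne_zero_iff.2 fun k _ => by positivity
      have hr := rising_ne_zero (x := ((n : ℝ) + 1) * q) (by positivity) m
      simp only [Finset.prod_mul_distrib, Finset.prod_div_distrib, Finset.prod_pow_eq_pow_sum,
        hlm]
      rw [hmul', mul_pow, mul_pow]
      field_simp
    rw [Finset.sum_congr rfl hterm, ← Finset.mul_sum, ← coeff_pow_eq_sum_piAntidiag,
      momentSeries_pow hh hq, coeff_momentSeries]
    have hr := rising_ne_zero (x := ((n : ℝ) + 1) * q) (by positivity) m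
    field_simp
  · intro l _
    exact ((integrable_dirichletLaw_prod_pow hq n ht l).mul_prod
      (Integrable.fintype_prod (f := fun k v => ⟪w, v⟫ ^ l k) fun k => hint (l k))).const_mul _

lemma norm_flightMap_le {n : ℕ} {c t : ℝ} (hc : 0 < c) (ht : 0 < t) {τ : Fin n → ℝ}
    (hτ : τ ∈ timeSimplex n t) {v : Fin (n + 1) → EuclideanSpace ℝ (Fin d)}
    (hv : ∀ k, ‖v k‖ = 1) : ‖flightMap n c t (τ, v)‖ ≤ c * t := by
  rw [flightMap, norm_smul, Real.norm_of_nonneg hc.le]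
  gcongr
  refine (norm_sum_le _ _).trans ?_
  refine le_of_eq ?_
  conv_rhs => rw [← sum_durations t τ]
  refine Finset.sum_congr rfl fun k _ => ?_
  rw [norm_smul, hv, mul_one, Real.norm_of_nonneg (durations_pos ht hτ k).le]

/-- Given `n ≥ 1` deviations, Dirichlet durations and uniform directions, the position of the free
flight has the density `ballProfile` with `κ = n (d - h) / 2`. -/
lemma map_flightMap {h : ℕ} (hh : h = 1 ∨ h = 2) (hd : h < d) {n : ℕ} (hn : 1 ≤ n) {c t : ℝ}
    (hc : 0 < c) (ht : 0 < t) :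
    ((dirichletLaw ((d : ℝ) / h - 1) n t).prod
        (Measure.pi fun _ : Fin (n + 1) => uniformSphere d 1)).map (flightMap n c t)
      = ballLaw d (((d : ℝ) - h) / 2 * n) (c * t) := by
  have hd0 : 0 < d := by omega
  have hh0 : (0 : ℝ) < h := by rcases hh with rfl | rfl <;> norm_num
  have hdh : (h : ℝ) < d := by exact_mod_cast hd
  have hn0 : (0 : ℝ) < n := by exact_mod_cast hn
  set q := (d : ℝ) / h - 1 with hqdef
  have hq : 0 < q := by rw [hqdef, sub_pos, one_lt_div hh0]; exact hdh
  have hdq : (h : ℝ) * (q + 1) = d := by rw [hqdef]; field_simp; ring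
  have hκ : 0 < ((d : ℝ) - h) / 2 * n := by
    have := sub_pos.2 hdh
    positivity
  have := isProbabilityMeasure_uniformSphere hd0 1
  have := isProbabilityMeasure_dirichletLaw hq n ht
  have := isProbabilityMeasure_ballLaw hd0 hκ (mul_pos hc ht)
  refine ext_of_inner_moments (a := c * t) ?_ ?_ fun w m => ?_
  · rw [ae_map_iff (measurable_flightMap n c t).aemeasurable
      (measurableSet_le measurable_norm measurable_const)]
    have h1 : ∀ᵐ p ∂((dirichletLaw q n t).prod
        (Measure.pi fun _ : Fin (n + 1) => uniformSphere d 1)), p.1 ∈ timeSimplex n t :=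
      Measure.quasiMeasurePreserving_fst.ae (ae_dirichletLaw_mem q n t)
    have h2 : ∀ᵐ p ∂((dirichletLaw q n t).prod
        (Measure.pi fun _ : Fin (n + 1) => uniformSphere d 1)), ∀ k, ‖p.2 k‖ = 1 := by
      refine Measure.quasiMeasurePreserving_snd.ae
        (p := fun v : Fin (n + 1) → EuclideanSpace ℝ (Fin d) => ∀ k, ‖v k‖ = 1) ?_
      refine ae_all_iff.2 fun k => ?_
      exact (measurePreserving_eval (fun _ : Fin (n + 1) => uniformSphere d 1)
        k).quasiMeasurePreserving.ae (ae_uniformSphere_norm zero_le_one)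
    filter_upwards [h1, h2] with p hp1 hp2
    exact norm_flightMap_le hc ht hp1 hp2
  · filter_upwards [ae_ballLaw_norm_lt (d := d) (((d : ℝ) - h) / 2 * n) (c * t)] with x hx
    exact hx.le
  · rw [integral_map (measurable_flightMap n c t).aemeasurable (by fun_prop),
      integral_flightMap_inner_pow hd0 hh hq hdq n ht,
      integral_ballLaw_inner_pow hd0 hκ (mul_pos hc ht)]
    congr 2
    rw [← hdq]
    ring

end FreeFlight

/-! ### The flight on the event of `n` deviations -/

section Flight

variable {Ω : Type*} {d : ℕ}

/-- The sequences of instants which have exactly `n` terms of index at least `1` in `[0, t]`. -/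
def deviationSet (t : ℝ) (n : ℕ) : Set (ℕ → ℝ) :=
  {s | numDeviations (fun k (s : ℕ → ℝ) => s k) t s = n}

lemma numDeviations_le_iff {T : ℕ → Ω → ℝ} {t : ℝ} {ω : Ω} {n : ℕ} :
    numDeviations T t ω ≤ n ↔ ∀ k, 1 ≤ k → T k ω ≤ t → k ≤ n := by
  simp only [numDeviations, Set.mem_ofPred_eq, iSup_le_iff, Nat.cast_le, and_imp]

lemma measurableSet_deviationSet (t : ℝ) (n : ℕ) : MeasurableSet (deviationSet t n) := by
  have hle : ∀ m : ℕ, MeasurableSet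
      {s : ℕ → ℝ | numDeviations (fun k (s : ℕ → ℝ) => s k) t s ≤ m} := by
    intro m
    have : {s : ℕ → ℝ | numDeviations (fun k (s : ℕ → ℝ) => s k) t s ≤ m}
        = ⋂ k : ℕ, {s : ℕ → ℝ | 1 ≤ k → s k ≤ t → k ≤ m} := by
      ext s
      simp only [Set.mem_ofPred_eq, numDeviations_le_iff, Set.mem_iInter]
    rw [this]
    refine MeasurableSet.iInter fun k => ?_
    by_cases h : 1 ≤ k ∧ ¬ k ≤ m
    · have : {s : ℕ → ℝ | 1 ≤ k → s k ≤ t → k ≤ m} = {s | s k ≤ t}ᶜ := by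
        ext s
        simp [h.1, h.2]
      rw [this]
      exact (measurableSet_le (measurable_pi_apply k) measurable_const).compl
    · have : {s : ℕ → ℝ | 1 ≤ k → s k ≤ t → k ≤ m} = Set.univ := by
        ext s
        simp only [Set.mem_ofPred_eq, Set.mem_univ, iff_true]
        tauto
      rw [this]
      exact MeasurableSet.univ
  cases n with
  | zero =>
    convert! hle 0 using 1
    ext s
    simp [deviationSet]
  | succ n =>
    convert! (hle (n + 1)).diff (hle n) using 1
    ext s
    simp only [deviationSet, Set.mem_ofPred_eq, Set.mem_sdiff, not_le]
    constructor
    · intro h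
      rw [h]
      exact ⟨le_rfl, by exact_mod_cast Nat.lt_succ_self n⟩
    · rintro ⟨h1, h2⟩
      refine le_antisymm h1 ?_
      push_cast
      exact Order.add_one_le_of_lt h2

lemma setOf_numDeviations_eq (T : ℕ → Ω → ℝ) (t : ℝ) (n : ℕ) :
    {ω | numDeviations T t ω = n} = (fun ω k => T k ω) ⁻¹' deviationSet t n := rfl

lemma measurableSet_numDeviations_eq [MeasurableSpace Ω] {T : ℕ → Ω → ℝ}
    (hT : ∀ k, Measurable (T k)) (t : ℝ) (n : ℕ) :
    MeasurableSet {ω | numDeviations T t ω = n} :=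
  measurable_pi_iff.2 hT (measurableSet_deviationSet t n)

lemma pairwise_disjoint_numDeviations_eq (T : ℕ → Ω → ℝ) (t : ℝ) :
    Pairwise (Function.onFun Disjoint fun n : ℕ => {ω | numDeviations T t ω = n}) := by
  intro m n hmn
  rw [Function.onFun, Set.disjoint_left]
  intro ω h1 h2
  rw [Set.mem_ofPred_eq] at h1 h2
  rw [h1] at h2
  exact hmn (by exact_mod_cast h2)

lemma flightPosition_eq_flightMap (c : ℝ) {T : ℕ → Ω → ℝ} (hT : ∀ ω, T 0 ω = 0)
    (V : ℕ → Ω → EuclideanSpace ℝ (Fin d)) {t : ℝ} {ω : Ω} {n : ℕ}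
    (hω : numDeviations T t ω = n) :
    flightPosition c T V t ω
      = flightMap n c t (fun k : Fin n => T ((k : ℕ) + 1) ω - T (k : ℕ) ω,
          fun k : Fin (n + 1) => V k ω) := by
  have hsum : ∑ k : Fin n, (T ((k : ℕ) + 1) ω - T (k : ℕ) ω) = T n ω := by
    rw [Fin.sum_univ_eq_sum_range fun k => T (k + 1) ω - T k ω,
      Finset.sum_range_sub fun k => T k ω, hT, sub_zero]
  simp only [flightPosition, hω, ENat.toNat_natCast, flightMap, Fin.sum_univ_castSucc, durations,
    Fin.snoc_castSucc, Fin.snoc_last, Fin.val_castSucc, Fin.val_last, hsum]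
  rw [Fin.sum_univ_eq_sum_range fun k => (T (k + 1) ω - T k ω) • V k ω]

variable [MeasurableSpace Ω] {P : Measure Ω}
  {T : ℕ → Ω → ℝ} {V : ℕ → Ω → EuclideanSpace ℝ (Fin d)}

/-- On the event of `n` deviations, which is determined by the instants, the first `n` durations
and the first `n + 1` directions are independent, and the directions are uniform. -/
lemma map_durations_directions [IsProbabilityMeasure P] (hf : IsRandomFlight P T V)
    (t : ℝ) (n : ℕ) :
    (P.restrict {ω | numDeviations T t ω = n}).map
        (fun ω => ((fun k : Fin n => T ((k : ℕ) + 1) ω - T (k : ℕ) ω),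
          fun k : Fin (n + 1) => V k ω))
      = ((P.restrict {ω | numDeviations T t ω = n}).map
          fun ω (k : Fin n) => T ((k : ℕ) + 1) ω - T (k : ℕ) ω).prod
        (Measure.pi fun _ : Fin (n + 1) => uniformSphere d 1) := by
  have hTm : Measurable fun ω k => T k ω := measurable_pi_iff.2 hf.measurable_time
  have hVm : Measurable fun ω k => V k ω := measurable_pi_iff.2 hf.measurable_dir
  have hA := measurableSet_deviationSet t n
  set A := deviationSet t n with hAdef
  set φ : (ℕ → ℝ) → (Fin n → ℝ) := fun s k => s ((k : ℕ) + 1) - s (k : ℕ) with hφ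
  set ψ : (ℕ → EuclideanSpace ℝ (Fin d)) → (Fin (n + 1) → EuclideanSpace ℝ (Fin d)) :=
    fun v k => v k with hψ
  have hφm : Measurable φ := by fun_prop
  have hψm : Measurable ψ := by fun_prop
  have hpi : (P.map fun ω k => V k ω).map ψ
      = Measure.pi fun _ : Fin (n + 1) => uniformSphere d 1 := by
    have hind : iIndepFun (fun k : Fin (n + 1) => V k) P :=
      hf.dir_indep.precomp (g := fun k : Fin (n + 1) => (k : ℕ)) Fin.val_injective
    have h := (iIndepFun_iff_map_fun_eq_pi_map (fun k => (hf.measurable_dir _).aemeasurable)).1 hind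
    rw [Measure.map_map hψm hVm]
    simp only [hf.dir_uniform] at h
    exact h
  have hprob : IsProbabilityMeasure (P.map fun ω k => V k ω) :=
    Measure.isProbabilityMeasure_map hVm.aemeasurable
  have hjoint := (indepFun_iff_map_prod_eq_prod_map_map hTm.aemeasurable hVm.aemeasurable).1
    hf.indep_time_dir
  have hres : (P.restrict ((fun ω k => T k ω) ⁻¹' A)).map (fun ω => ((fun k => T k ω),
      fun k => V k ω)) = ((P.map fun ω k => T k ω).restrict A).prod (P.map fun ω k => V k ω) := by
    have h1 : (fun ω k => T k ω) ⁻¹' A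
        = (fun ω => ((fun k => T k ω), fun k => V k ω)) ⁻¹' (A ×ˢ Set.univ) := by
      ext ω
      simp
    rw [h1, ← Measure.restrict_map (hTm.prodMk hVm) (hA.prod MeasurableSet.univ), hjoint,
      ← Measure.prod_restrict, Measure.restrict_univ]
  rw [setOf_numDeviations_eq, ← hAdef]
  have h2 : (fun ω => ((fun k : Fin n => T ((k : ℕ) + 1) ω - T (k : ℕ) ω),
      fun k : Fin (n + 1) => V k ω))
      = Prod.map φ ψ ∘ fun ω => ((fun k => T k ω), fun k => V k ω) := rfl
  rw [h2, ← Measure.map_map (hφm.prodMap hψm) (hTm.prodMk hVm), hres,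
    ← Measure.map_prod_map _ _ hφm hψm, hpi, Measure.restrict_map hTm hA,
    Measure.map_map hφm hTm]
  rfl

lemma map_flightPosition_restrict [IsProbabilityMeasure P] (hf : IsRandomFlight P T V)
    (c t : ℝ) (n : ℕ) :
    (P.restrict {ω | numDeviations T t ω = n}).map (flightPosition c T V t)
      = (((P.restrict {ω | numDeviations T t ω = n}).map
          fun ω (k : Fin n) => T ((k : ℕ) + 1) ω - T (k : ℕ) ω).prod
        (Measure.pi fun _ : Fin (n + 1) => uniformSphere d 1)).map (flightMap n c t) := by
  have hT := hf.measurable_time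
  have hV := hf.measurable_dir
  rw [← map_durations_directions hf, Measure.map_map (measurable_flightMap n c t)]
  · refine Measure.map_congr ?_
    filter_upwards [ae_restrict_mem (measurableSet_numDeviations_eq hT t n)] with ω hω
    exact flightPosition_eq_flightMap c hf.time_zero V hω
  · exact (measurable_pi_iff.2 fun k => (hT _).sub (hT _)).prodMk
      (measurable_pi_iff.2 fun k => hV _)

lemma aemeasurable_flightPosition_restrict (hf : IsRandomFlight P T V) (c t : ℝ) (n : ℕ) :
    AEMeasurable (flightPosition c T V t) (P.restrict {ω | numDeviations T t ω = n}) := by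
  have hT := hf.measurable_time
  have hV := hf.measurable_dir
  refine ⟨fun ω => flightMap n c t (fun k : Fin n => T ((k : ℕ) + 1) ω - T (k : ℕ) ω,
          fun k : Fin (n + 1) => V k ω), (measurable_flightMap n c t).comp ?_, ?_⟩
  · exact (measurable_pi_iff.2 fun k => (hT _).sub (hT _)).prodMk
      (measurable_pi_iff.2 fun k => hV _)
  · filter_upwards [ae_restrict_mem (measurableSet_numDeviations_eq hT t n)] with ω hω
    exact flightPosition_eq_flightMap c hf.time_zero V hω

lemma map_flightPosition_of_pos [IsProbabilityMeasure P] (hf : IsRandomFlight P T V)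
    {h : ℕ} (hh : h = 1 ∨ h = 2)
    (hd : h < d) {c t : ℝ} (hc : 0 < c) (ht : 0 < t)
    (hdir : HasDirichletDisplacements P T d h t) {n : ℕ} (hn : 1 ≤ n)
    (hpos : P {ω | numDeviations T t ω = n} ≠ 0) :
    (P.restrict {ω | numDeviations T t ω = n}).map (flightPosition c T V t)
      = P {ω | numDeviations T t ω = n} • ballLaw d (((d : ℝ) - h) / 2 * n) (c * t) := by
  have hcond : P.restrict {ω | numDeviations T t ω = n} = P {ω | numDeviations T t ω = n} •
      ProbabilityTheory.cond P {ω | numDeviations T t ω = n} := by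
    rw [ProbabilityTheory.cond, smul_smul, ENNReal.mul_inv_cancel hpos (measure_ne_top _ _),
      one_smul]
  have : IsProbabilityMeasure (uniformSphere d 1) :=
    isProbabilityMeasure_uniformSphere (by omega) 1
  have hs : SFinite (dirichletLaw ((d : ℝ) / h - 1) n t) := by
    rw [dirichletLaw]
    infer_instance
  rw [map_flightPosition_restrict hf, hcond, Measure.map_smul, hdir n hn, Measure.prod_smul_left,
    Measure.map_smul, map_flightMap hh hd hn hc ht]

lemma map_flightPosition_zero [IsProbabilityMeasure P] (hf : IsRandomFlight P T V) (hd : 0 < d)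
    (c t : ℝ) :
    (P.restrict {ω | numDeviations T t ω = (0 : ℕ)}).map (flightPosition c T V t)
      = P {ω | numDeviations T t ω = (0 : ℕ)} • uniformSphere d (c * t) := by
  have : IsProbabilityMeasure (uniformSphere d 1) := isProbabilityMeasure_uniformSphere hd 1
  set μ := (P.restrict {ω | numDeviations T t ω = (0 : ℕ)}).map
    fun ω (k : Fin 0) => T ((k : ℕ) + 1) ω - T (k : ℕ) ω with hμ
  have hT := hf.measurable_time
  have hμu : μ Set.univ = P {ω | numDeviations T t ω = (0 : ℕ)} := by
    have hm : Measurable fun ω (k : Fin 0) => T ((k : ℕ) + 1) ω - T (k : ℕ) ω :=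
      measurable_pi_iff.2 fun k => k.elim0
    rw [hμ, Measure.map_apply hm MeasurableSet.univ]
    simp
  have h1 : flightMap (d := d) 0 c t
      = (fun v => (c * t) • v) ∘ (fun v : Fin 1 → EuclideanSpace ℝ (Fin d) => v 0) ∘ Prod.snd := by
    ext1 p
    simp [flightMap, durations, smul_smul, Fin.snoc]
  have h2 : uniformSphere d (c * t) = (uniformSphere d 1).map fun v => (c * t) • v := by
    rw [uniformSphere, uniformSphere, Measure.map_map (by fun_prop) (by fun_prop)]
    congr 1
    ext1 v
    simp
  have h3 : (μ.prod (Measure.pi fun _ : Fin 1 => uniformSphere d 1)).map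
      ((fun v : Fin 1 → EuclideanSpace ℝ (Fin d) => v 0) ∘ Prod.snd)
      = P {ω | numDeviations T t ω = (0 : ℕ)} • uniformSphere d 1 := by
    rw [← Measure.map_map (measurable_pi_apply 0) measurable_snd, Measure.map_snd_prod, hμu,
      Measure.map_smul, (measurePreserving_eval (fun _ : Fin 1 => uniformSphere d 1) 0).map_eq]
  have h4 : Measurable ((fun v : Fin 1 → EuclideanSpace ℝ (Fin d) => v 0) ∘
      (Prod.snd : (Fin 0 → ℝ) × (Fin 1 → EuclideanSpace ℝ (Fin d)) → _)) :=
    (measurable_pi_apply 0).comp measurable_snd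
  have h5 : Measurable fun v : EuclideanSpace ℝ (Fin d) => (c * t) • v := by fun_prop
  rw [map_flightPosition_restrict hf, ← hμ, h1, h2, ← Measure.map_smul, ← h3]
  exact (Measure.map_map h5 h4).symm

end Flight

/-! ### Reflection in a sphere -/

section Reflection

variable {d : ℕ}

lemma norm_inversion (R : ℝ) (x : EuclideanSpace ℝ (Fin d)) :
    ‖EuclideanGeometry.inversion 0 R x‖ = R ^ 2 / ‖x‖ := by
  simpa only [dist_zero_right] using EuclideanGeometry.dist_inversion_center 0 x R

lemma measurable_inversion (R : ℝ) :
    Measurable (EuclideanGeometry.inversion (0 : EuclideanSpace ℝ (Fin d)) R) := by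
  have : EuclideanGeometry.inversion (0 : EuclideanSpace ℝ (Fin d)) R
      = fun x => (R / ‖x‖) ^ 2 • x := by
    ext1 x
    simp [EuclideanGeometry.inversion]
  rw [this]
  fun_prop

lemma abs_det_inversion (R : ℝ) (x : EuclideanSpace ℝ (Fin d)) :
    |(((R / dist x 0) ^ 2 • ((ℝ ∙ (x - 0))ᗮ.reflection :
      EuclideanSpace ℝ (Fin d) →L[ℝ] EuclideanSpace ℝ (Fin d)))).det|
      = R ^ (2 * d) / ‖x‖ ^ (2 * d) := by
  have h1 : |LinearMap.det ((ℝ ∙ (x - 0))ᗮ.reflection.toLinearMap)| = 1 := by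
    rw [Submodule.det_reflection, abs_pow, abs_neg, abs_one, one_pow]
  rw [ContinuousLinearMap.det, ContinuousLinearMap.toLinearMap_smul, LinearMap.det_smul, abs_mul]
  have h2 : |LinearMap.det (((ℝ ∙ (x - 0))ᗮ.reflection :
      EuclideanSpace ℝ (Fin d) →L[ℝ] EuclideanSpace ℝ (Fin d)) :
      EuclideanSpace ℝ (Fin d) →ₗ[ℝ] EuclideanSpace ℝ (Fin d))| = 1 := h1
  rw [h2, mul_one, finrank_euclideanSpace_fin, dist_zero_right, ← pow_mul, div_pow, abs_of_nonneg]
  rw [pow_mul, pow_mul]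
  positivity

/-- The reflection of a point: the identity inside the ball of radius `R`, the inversion on the
shell between `R` and `b`, and `0` elsewhere. -/
def ballReflection (d : ℕ) (R b : ℝ) (x : EuclideanSpace ℝ (Fin d)) : EuclideanSpace ℝ (Fin d) :=
  (Metric.ball 0 R).indicator id x + (shell d R b).indicator (EuclideanGeometry.inversion 0 R) x

lemma measurableSet_shell (a b : ℝ) : MeasurableSet (shell d a b) :=
  (measurableSet_lt measurable_const measurable_norm).inter
    (measurableSet_le measurable_norm measurable_const)

lemma measurable_ballReflection (d : ℕ) (R b : ℝ) : Measurable (ballReflection d R b) :=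
  (measurable_id.indicator measurableSet_ball).add
    ((measurable_inversion R).indicator (measurableSet_shell R b))

lemma volume_norm_eq {r : ℝ} (hr : 0 < r) :
    (volume : Measure (EuclideanSpace ℝ (Fin d))) {x | ‖x‖ = r} = 0 := by
  have := Measure.addHaar_sphere_of_ne_zero
    (volume : Measure (EuclideanSpace ℝ (Fin d))) 0 hr.ne'
  convert! this using 2
  ext x
  simp

lemma shell_inter_preimage_inversion {R b : ℝ} (hR : 0 < R) (hRb : R < b)
    (A : Set (EuclideanSpace ℝ (Fin d))) :
    {x : EuclideanSpace ℝ (Fin d) | R < ‖x‖ ∧ ‖x‖ < b} ∩ EuclideanGeometry.inversion 0 R ⁻¹' A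
      = EuclideanGeometry.inversion 0 R '' ({y | R ^ 2 / b < ‖y‖ ∧ ‖y‖ < R} ∩ A) := by
  have hb : 0 < b := hR.trans hRb
  ext x
  constructor
  · rintro ⟨⟨h1, h2⟩, h3⟩
    refine ⟨EuclideanGeometry.inversion 0 R x, ⟨⟨?_, ?_⟩, h3⟩,
      EuclideanGeometry.inversion_inversion 0 hR.ne' x⟩
    · rw [norm_inversion]
      have := hR.trans h1
      gcongr
    · rw [norm_inversion, div_lt_iff₀ (hR.trans h1)]
      nlinarith
  · rintro ⟨y, ⟨⟨h1, h2⟩, h3⟩, rfl⟩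
    have hy : 0 < ‖y‖ := lt_trans (by positivity) h1
    refine ⟨⟨?_, ?_⟩, ?_⟩
    · rw [norm_inversion, lt_div_iff₀ hy]
      nlinarith
    · rw [norm_inversion]
      rw [div_lt_iff₀ hb] at h1
      rw [div_lt_iff₀ hy]
      linarith
    · rwa [Set.mem_preimage, EuclideanGeometry.inversion_inversion 0 hR.ne' y]

/-- Change of variables `y = inversion x` between the open shells. -/
lemma lintegral_inversion {R b : ℝ} (hR : 0 < R) (hRb : R < b) (F : ℝ → ENNReal)
    (A : Set (EuclideanSpace ℝ (Fin d))) (hA : MeasurableSet A) :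
    ∫⁻ x in {x | R < ‖x‖ ∧ ‖x‖ < b} ∩ EuclideanGeometry.inversion 0 R ⁻¹' A, F ‖x‖
      = ∫⁻ y in {y | R ^ 2 / b < ‖y‖ ∧ ‖y‖ < R} ∩ A,
          ENNReal.ofReal (R ^ (2 * d) / ‖y‖ ^ (2 * d)) * F (R ^ 2 / ‖y‖) := by
  have hb : 0 < b := hR.trans hRb
  have hS : MeasurableSet ({y : EuclideanSpace ℝ (Fin d) | R ^ 2 / b < ‖y‖ ∧ ‖y‖ < R} ∩ A) :=
    ((measurableSet_lt measurable_const measurable_norm).inter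
      (measurableSet_lt measurable_norm measurable_const)).inter hA
  have hderiv : ∀ x ∈ {y : EuclideanSpace ℝ (Fin d) | R ^ 2 / b < ‖y‖ ∧ ‖y‖ < R} ∩ A,
      HasFDerivWithinAt (EuclideanGeometry.inversion 0 R)
        ((R / dist x 0) ^ 2 • ((ℝ ∙ (x - 0))ᗮ.reflection :
          EuclideanSpace ℝ (Fin d) →L[ℝ] EuclideanSpace ℝ (Fin d)))
        ({y | R ^ 2 / b < ‖y‖ ∧ ‖y‖ < R} ∩ A) x := by
    intro x hx
    have h0 : 0 < ‖x‖ := lt_trans (by positivity) hx.1.1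
    exact (EuclideanGeometry.hasFDerivAt_inversion (norm_pos_iff.1 h0)).hasFDerivWithinAt
  have hinj : Set.InjOn (EuclideanGeometry.inversion 0 R)
      ({y : EuclideanSpace ℝ (Fin d) | R ^ 2 / b < ‖y‖ ∧ ‖y‖ < R} ∩ A) :=
    (EuclideanGeometry.inversion_injective 0 hR.ne').injOn
  have h := lintegral_image_eq_lintegral_abs_det_fderiv_mul volume hS hderiv hinj
    fun x => F ‖x‖
  rw [shell_inter_preimage_inversion hR hRb, h]
  refine lintegral_congr fun x => ?_
  rw [abs_det_inversion, norm_inversion]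

/-- The law of the reflection of a vector with a radial density that vanishes outside the ball of
radius `b`. -/
lemma map_ballReflection {R b : ℝ} (hR : 0 < R) (hRb : R < b) {F : ℝ → ENNReal}
    (hF : Measurable F) (hFb : ∀ r, b ≤ r → F r = 0) :
    ((volume : Measure (EuclideanSpace ℝ (Fin d))).withDensity fun x => F ‖x‖).map
        (ballReflection d R b)
      = volume.withDensity fun y => (Metric.ball 0 R).indicator (fun y => F ‖y‖) y
        + (shell d (R ^ 2 / b) R).indicator
          (fun y => ENNReal.ofReal (R ^ (2 * d) / ‖y‖ ^ (2 * d)) * F (R ^ 2 / ‖y‖)) y := by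
  ext A hA
  have hFn : Measurable fun x : EuclideanSpace ℝ (Fin d) => F ‖x‖ := hF.comp measurable_norm
  have hpre : MeasurableSet (ballReflection d R b ⁻¹' A) := measurable_ballReflection d R b hA
  set B : Set (EuclideanSpace ℝ (Fin d)) := Metric.ball 0 R with hB
  have hBm : MeasurableSet B := measurableSet_ball
  set S : Set (EuclideanSpace ℝ (Fin d)) := {x | R < ‖x‖ ∧ ‖x‖ < b} with hS
  have hSm : MeasurableSet S := (measurableSet_lt measurable_const measurable_norm).inter
      (measurableSet_lt measurable_norm measurable_const)
  have hBS : Disjoint B S := by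
    rw [Set.disjoint_left]
    intro x hx hx'
    rw [hB, mem_ball_zero_iff] at hx
    exact lt_asymm hx hx'.1
  -- up to a null set the density lives on the ball and on the open shell
  have hzero : ∫⁻ x in ballReflection d R b ⁻¹' A ∩ (B ∪ S)ᶜ, F ‖x‖ = 0 := by
    rw [lintegral_eq_zero_iff hFn]
    have hne : ∀ᵐ x : EuclideanSpace ℝ (Fin d), ‖x‖ ≠ R := by
      rw [ae_iff]
      simpa using volume_norm_eq (d := d) hR
    filter_upwards [ae_restrict_mem (hpre.inter (hBm.union hSm).compl),
      ae_restrict_of_ae hne] with x hx hxR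
    refine hFb _ ?_
    by_contra h
    have hx2 := hx.2
    simp only [Set.mem_compl_iff, Set.mem_union, hB, hS, mem_ball_zero_iff, Set.mem_ofPred_eq,
      not_or, not_lt, not_and] at hx2
    exact h (hx2.2 (lt_of_le_of_ne hx2.1 (Ne.symm hxR)))
  have hrB : ballReflection d R b ⁻¹' A ∩ B = A ∩ B := by
    ext x
    simp only [Set.mem_inter_iff, Set.mem_preimage, and_congr_left_iff]
    intro hx
    have hxs : x ∉ shell d R b := fun h => by
      rw [hB, mem_ball_zero_iff] at hx
      exact lt_asymm hx h.1
    rw [ballReflection, Set.indicator_of_mem hx, Set.indicator_of_notMem hxs, id, add_zero]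
  have hrS : ballReflection d R b ⁻¹' A ∩ S = S ∩ EuclideanGeometry.inversion 0 R ⁻¹' A := by
    rw [Set.inter_comm]
    ext x
    simp only [Set.mem_inter_iff, Set.mem_preimage, and_congr_right_iff]
    intro hx
    have hxs : x ∈ shell d R b := ⟨hx.1, hx.2.le⟩
    rw [ballReflection, Set.indicator_of_notMem (Set.disjoint_right.1 hBS hx),
      Set.indicator_of_mem hxs, zero_add]
  have hshell : (shell d (R ^ 2 / b) R : Set (EuclideanSpace ℝ (Fin d)))
      =ᵐ[volume] {y | R ^ 2 / b < ‖y‖ ∧ ‖y‖ < R} := by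
    have hne : ∀ᵐ x : EuclideanSpace ℝ (Fin d), ‖x‖ ≠ R := by
      rw [ae_iff]
      simpa using volume_norm_eq (d := d) hR
    filter_upwards [hne] with x hx
    refine propext ⟨fun h => ⟨h.1, lt_of_le_of_ne h.2 hx⟩, fun h => ⟨h.1, h.2.le⟩⟩
  rw [Measure.map_apply (measurable_ballReflection d R b) hA, withDensity_apply _ hpre,
    withDensity_apply _ hA, ← lintegral_inter_add_sdiff (fun x => F ‖x‖) _ (hBm.union hSm),
    Set.sdiff_eq, hzero, add_zero, Set.inter_union_distrib_left, hrB, hrS,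
    lintegral_union ((hSm.inter (measurable_inversion R hA)))
      (hBS.mono Set.inter_subset_right Set.inter_subset_left),
    lintegral_inversion hR hRb F A hA, lintegral_add_left (hFn.indicator hBm),
    lintegral_indicator hBm, lintegral_indicator (measurableSet_shell _ _),
    Measure.restrict_restrict hBm, Measure.restrict_restrict (measurableSet_shell _ _),
    Set.inter_comm A B,
    Measure.restrict_congr_set (hshell.inter (Filter.EventuallyEq.refl _ A))]

/-- The reflection of a uniform vector of the sphere of radius `b` is uniform on the sphere of
radius `R² / b`. -/
lemma map_inversion_uniformSphere {R b : ℝ} (hb : 0 < b) :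
    (uniformSphere d b).map
        ((Metric.sphere 0 b).indicator (EuclideanGeometry.inversion 0 R))
      = uniformSphere d (R ^ 2 / b) := by
  rw [uniformSphere, Measure.map_map ((measurable_inversion R).indicator
    Metric.isClosed_sphere.measurableSet) (by fun_prop), uniformSphere]
  congr 1
  ext1 v
  have hv : ‖(v : EuclideanSpace ℝ (Fin d))‖ = 1 := norm_eq_of_mem_sphere v
  have hmem : b • (v : EuclideanSpace ℝ (Fin d)) ∈ Metric.sphere 0 b := by
    rw [mem_sphere_zero_iff_norm, norm_smul, hv, mul_one, Real.norm_of_nonneg hb.le]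
  rw [Function.comp_apply, Set.indicator_of_mem hmem, EuclideanGeometry.inversion,
    dist_zero_right, norm_smul, hv, mul_one, Real.norm_of_nonneg hb.le, vsub_eq_sub, sub_zero,
    vadd_eq_add, add_zero, smul_smul]
  congr 1
  field_simp

end Reflection

/-! ### Mittag-Leffler series -/

lemma rpow_mul_exp_neg_le_Gamma {A y : ℝ} (hA : 0 < A) (hy : 1 ≤ y) :
    A ^ (y - 1) * Real.exp (-A) ≤ Real.Gamma y := by
  have hy0 : 0 < y := by linarith
  have hint := Real.GammaIntegral_convergent hy0
  have hsub : Set.Ioi A ⊆ Set.Ioi 0 := Set.Ioi_subset_Ioi hA.le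
  calc
    A ^ (y - 1) * Real.exp (-A) = ∫ u in Set.Ioi A, Real.exp (-u) * A ^ (y - 1) := by
      rw [integral_mul_const, integral_exp_neg_Ioi, mul_comm]
    _ ≤ ∫ u in Set.Ioi A, Real.exp (-u) * u ^ (y - 1) := by
      refine setIntegral_mono_on ((integrableOn_exp_neg_Ioi A).mul_const _) (hint.mono_set hsub)
        measurableSet_Ioi fun u hu => ?_
      have : A ≤ u := (Set.mem_Ioi.1 hu).le
      gcongr
    _ ≤ ∫ u in Set.Ioi 0, Real.exp (-u) * u ^ (y - 1) := by
      refine setIntegral_mono_set hint ?_ hsub.eventuallyLE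
      filter_upwards [ae_restrict_mem measurableSet_Ioi] with u hu
      have : 0 < u := hu
      simp only [Pi.zero_apply]
      positivity
    _ = Real.Gamma y := (Real.Gamma_eq_integral hy0).symm

lemma summable_mittagLeffler {α β x : ℝ} (hα : 0 < α) (hβ : 0 < β) (hx : 0 ≤ x) :
    Summable fun k : ℕ => x ^ k / Real.Gamma (α * k + β) := by
  -- with `A ^ α = 2 x + 1` the terms are dominated by those of a geometric series
  set A := (2 * x + 1) ^ (1 / α) with hA
  have hA0 : 0 < A := by positivity
  have hAα : A ^ α = 2 * x + 1 := by
    rw [hA, ← Real.rpow_mul (by positivity), one_div_mul_cancel hα.ne', Real.rpow_one]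
  have hgeom : Summable fun k : ℕ => (Real.exp A * A ^ (1 - β)) * (x / (2 * x + 1)) ^ k := by
    refine (summable_geometric_of_lt_one (by positivity) ?_).mul_left _
    rw [div_lt_one (by positivity)]
    linarith
  refine Summable.of_norm_bounded_eventually_nat hgeom ?_
  obtain ⟨K, hK⟩ := exists_nat_gt (1 / α)
  filter_upwards [Filter.eventually_ge_atTop K] with k hk
  have h1 : 1 ≤ α * k + β := by
    have : (K : ℝ) ≤ k := by exact_mod_cast hk
    have h2 : 1 / α < k := hK.trans_le this
    rw [div_lt_iff₀ hα] at h2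
    linarith
  have hG := rpow_mul_exp_neg_le_Gamma hA0 h1
  have hG0 : 0 < Real.Gamma (α * k + β) := Real.Gamma_pos_of_pos (by linarith)
  rw [Real.norm_of_nonneg (by positivity)]
  have h3 : A ^ (α * k + β - 1) = (2 * x + 1) ^ k / A ^ (1 - β) := by
    rw [show α * k + β - 1 = α * k - (1 - β) by ring, Real.rpow_sub hA0, Real.rpow_mul hA0.le,
      hAα, Real.rpow_natCast]
  calc
    x ^ k / Real.Gamma (α * k + β) ≤ x ^ k / (A ^ (α * k + β - 1) * Real.exp (-A)) := by gcongr
    _ = Real.exp A * A ^ (1 - β) * (x / (2 * x + 1)) ^ k := by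
      rw [h3, Real.exp_neg, div_pow]
      have : 0 < A ^ (1 - β) := by positivity
      field_simp

lemma hasSum_mittagLeffler {α β x : ℝ} (hα : 0 < α) (hβ : 0 < β) (hx : 0 ≤ x) :
    HasSum (fun k : ℕ => x ^ k / Real.Gamma (α * k + β)) (mittagLeffler α β x) :=
  (summable_mittagLeffler hα hβ hx).hasSum

lemma mittagLeffler_pos {α β x : ℝ} (hα : 0 < α) (hβ : 0 < β) (hx : 0 ≤ x) :
    0 < mittagLeffler α β x := by
  refine (summable_mittagLeffler hα hβ hx).tsum_pos (fun k => ?_) 0 ?_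
  · have : 0 < Real.Gamma (α * k + β) := Real.Gamma_pos_of_pos (by positivity)
    positivity
  · have : 0 < Real.Gamma β := Real.Gamma_pos_of_pos hβ
    simpa

/-! ### The law of the reflected flight -/

/-- The weight `P(N(t) = n)` of the law of the number of deviations. -/
def deviationWeight (d h : ℕ) (lam t : ℝ) (n : ℕ) : ℝ :=
  1 / mittagLeffler (((d : ℝ) - h) / 2) ((d : ℝ) / 2) (lam * t)
      * ((lam * t) ^ n / Real.Gamma (((d : ℝ) - h) / 2 * (n : ℝ) + (d : ℝ) / 2))

section Weights

variable {d h : ℕ} {lam t : ℝ}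

lemma mittagLeffler_normalisation_pos (hd : h < d) (hlam : 0 < lam) (ht : 0 < t) :
    0 < mittagLeffler (((d : ℝ) - h) / 2) ((d : ℝ) / 2) (lam * t) := by
  have hdh : (0 : ℝ) < (d : ℝ) - h := sub_pos.2 (by exact_mod_cast hd)
  have hd0 : (0 : ℝ) < d := by exact_mod_cast (by omega : 0 < d)
  exact mittagLeffler_pos (by positivity) (by positivity) (by positivity)

lemma deviationWeight_pos (hd : h < d) (hlam : 0 < lam) (ht : 0 < t) (n : ℕ) :
    0 < deviationWeight d h lam t n := by
  have hdh : (0 : ℝ) < (d : ℝ) - h := sub_pos.2 (by exact_mod_cast hd)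
  have hd0 : (0 : ℝ) < d := by exact_mod_cast (by omega : 0 < d)
  have h1 := mittagLeffler_normalisation_pos hd hlam ht
  have h2 : 0 < Real.Gamma (((d : ℝ) - h) / 2 * (n : ℝ) + (d : ℝ) / 2) :=
    Real.Gamma_pos_of_pos (by positivity)
  unfold deviationWeight
  positivity

lemma hasSum_deviationWeight (hd : h < d) (hlam : 0 < lam) (ht : 0 < t) :
    HasSum (deviationWeight d h lam t) 1 := by
  have hdh : (0 : ℝ) < (d : ℝ) - h := sub_pos.2 (by exact_mod_cast hd)
  have hd0 : (0 : ℝ) < d := by exact_mod_cast (by omega : 0 < d)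
  have h1 := mittagLeffler_normalisation_pos hd hlam ht
  have := (hasSum_mittagLeffler (α := ((d : ℝ) - h) / 2) (β := (d : ℝ) / 2) (x := lam * t)
    (by positivity) (by positivity) (by positivity)).mul_left
    (1 / mittagLeffler (((d : ℝ) - h) / 2) ((d : ℝ) / 2) (lam * t))
  rwa [one_div_mul_cancel h1.ne'] at this

/-- The constant in front of the two radial factors of `reflectedDensity`. -/
def densityConst (d h : ℕ) (lam c t : ℝ) : ℝ :=
  (lam * t) ^ (2 / ((d : ℝ) - h)) / ((c * t) ^ d * Real.pi ^ ((d : ℝ) / 2))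
    * (1 / mittagLeffler (((d : ℝ) - h) / 2) ((d : ℝ) / 2) (lam * t))

variable {c r : ℝ}

lemma one_sub_sq_div_pos (hc : 0 < c) (ht : 0 < t) (hr : 0 ≤ r) (hrb : r < c * t) :
    0 < 1 - r ^ 2 / (c ^ 2 * t ^ 2) := by
  rw [sub_pos, div_lt_one (by positivity), ← mul_pow]
  gcongr

lemma radialFactor_nonneg (hd : h < d) (hlam : 0 < lam) (hc : 0 < c) (ht : 0 < t) (hr : 0 ≤ r)
    (hrb : r < c * t) : 0 ≤ radialFactor d h lam c r t := by
  have hdh : (0 : ℝ) < (d : ℝ) - h := sub_pos.2 (by exact_mod_cast hd)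
  have h1 := one_sub_sq_div_pos hc ht hr hrb
  have h2 : 0 < gammaH d h lam c r t := by
    unfold gammaH
    positivity
  have h3 := mittagLeffler_pos (α := ((d : ℝ) - h) / 2) (β := ((d : ℝ) - h) / 2)
    (by positivity) (by positivity) h2.le
  unfold radialFactor
  positivity

lemma densityConst_nonneg (hd : h < d) (hlam : 0 < lam) (hc : 0 < c) (ht : 0 < t) :
    0 ≤ densityConst d h lam c t := by
  have := mittagLeffler_normalisation_pos hd hlam ht
  unfold densityConst
  positivity

/-- Averaging the radial densities over the number of deviations produces a Mittag-Leffler series: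
the Gamma factors of the weights cancel those of the densities. -/
lemma hasSum_deviationWeight_mul_ballProfile (hd : h < d) (hlam : 0 < lam) (hc : 0 < c)
    (ht : 0 < t) (hr : 0 ≤ r) (hrb : r < c * t) :
    HasSum (fun n : ℕ => deviationWeight d h lam t (n + 1)
        * ballProfile d (((d : ℝ) - h) / 2 * ((n + 1 : ℕ) : ℝ)) (c * t) r)
      (densityConst d h lam c t * radialFactor d h lam c r t) := by
  have hdh : (0 : ℝ) < (d : ℝ) - h := sub_pos.2 (by exact_mod_cast hd)
  have hd0 : (0 : ℝ) < d := by exact_mod_cast (by omega : 0 < d)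
  have hE := mittagLeffler_normalisation_pos hd hlam ht
  set E := mittagLeffler (((d : ℝ) - h) / 2) ((d : ℝ) / 2) (lam * t) with hEdef
  have hy := one_sub_sq_div_pos hc ht hr hrb
  have hγdef : gammaH d h lam c r t
      = lam * t * (1 - r ^ 2 / (c ^ 2 * t ^ 2)) ^ (((d : ℝ) - h) / 2) := rfl
  set y := 1 - r ^ 2 / (c ^ 2 * t ^ 2) with hydef
  set α := ((d : ℝ) - h) / 2 with hα
  set γ := gammaH d h lam c r t with hγ
  have hα0 : 0 < α := by positivity
  have hγ0 : 0 < γ := by rw [hγdef]; positivity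
  have hct : 0 < c * t := by positivity
  have hsq : (c * t) ^ 2 - r ^ 2 = (c * t) ^ 2 * y := by
    rw [hydef]
    field_simp
  have hconst : densityConst d h lam c t * radialFactor d h lam c r t
      = 1 / (E * (Real.pi ^ ((d : ℝ) / 2) * (c * t) ^ d)) * y⁻¹ * γ * mittagLeffler α α γ := by
    rw [densityConst, radialFactor, ← hγ, ← hα, ← hEdef]
    have h2α : 2 / ((d : ℝ) - h) = 1 / α := by rw [hα]; field_simp
    have h1 : γ ^ (1 / α) = (lam * t) ^ (1 / α) * y := by
      rw [hγdef, Real.mul_rpow (by positivity) (by positivity), ← Real.rpow_mul hy.le,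
        mul_one_div_cancel hα0.ne', Real.rpow_one]
    rw [h2α, Real.rpow_sub hγ0, Real.rpow_one, h1]
    have : 0 < (lam * t) ^ (1 / α) := by positivity
    field_simp
  rw [hconst]
  refine ((hasSum_mittagLeffler hα0 hα0 hγ0.le).mul_left _).congr_fun fun n => ?_
  rw [deviationWeight, ballProfile, Set.indicator_of_mem (Set.mem_Iio.2 hrb), ← hα, ← hEdef, hsq]
  have hκ : 0 < α * ((n + 1 : ℕ) : ℝ) := by positivity
  have h1 : 0 < Real.Gamma (α * ((n + 1 : ℕ) : ℝ) + (d : ℝ) / 2) :=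
    Real.Gamma_pos_of_pos (by positivity)
  have h2 : 0 < Real.Gamma (α * ((n + 1 : ℕ) : ℝ)) := Real.Gamma_pos_of_pos hκ
  rw [show α * (n : ℝ) + α = α * ((n + 1 : ℕ) : ℝ) by push_cast; ring,
    add_comm ((d : ℝ) / 2)]
  have h3 : ((c * t) ^ 2 * y) ^ (α * ((n + 1 : ℕ) : ℝ) - 1)
      = (c * t) ^ ((d : ℝ) + 2 * (α * ((n + 1 : ℕ) : ℝ)) - 2) / (c * t) ^ d
        * ((y ^ α) ^ (n + 1) / y) := by
    rw [Real.mul_rpow (by positivity) hy.le, ← Real.rpow_natCast (c * t) 2,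
      ← Real.rpow_mul hct.le, Real.rpow_sub hy, Real.rpow_mul hy.le, Real.rpow_natCast (y ^ α),
      Real.rpow_one, ← Real.rpow_natCast (c * t) d, ← Real.rpow_sub hct]
    congr 2
    push_cast
    ring
  have h4 : γ ^ (n + 1) = (lam * t) ^ (n + 1) * (y ^ α) ^ (n + 1) := by rw [hγdef, mul_pow]
  have h5 : 0 < (c * t) ^ ((d : ℝ) + 2 * (α * ((n + 1 : ℕ) : ℝ)) - 2) := by positivity
  have h6 : 0 < Real.pi ^ ((d : ℝ) / 2) := by positivity
  rw [h3]
  have h7 : γ * (γ ^ n / Real.Gamma (α * ((n + 1 : ℕ) : ℝ)))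
      = (lam * t) ^ (n + 1) * (y ^ α) ^ (n + 1) / Real.Gamma (α * ((n + 1 : ℕ) : ℝ)) := by
    rw [← h4, pow_succ']
    ring
  rw [mul_assoc _ γ, h7]
  field_simp

/-- The radial profile of the absolutely continuous part of the law of the free flight. -/
def flightProfile (d h : ℕ) (lam c t r : ℝ) : ENNReal :=
  ∑' n : ℕ, ENNReal.ofReal (deviationWeight d h lam t (n + 1))
    * ENNReal.ofReal (ballProfile d (((d : ℝ) - h) / 2 * ((n + 1 : ℕ) : ℝ)) (c * t) r)

lemma measurable_flightProfile (d h : ℕ) (lam c t : ℝ) :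
    Measurable (flightProfile d h lam c t) :=
  Measurable.tsum fun _ => (measurable_ballProfile _ _ _).ennreal_ofReal.const_mul _

lemma flightProfile_of_le (hr : c * t ≤ r) : flightProfile d h lam c t r = 0 := by
  have : ∀ κ, ballProfile d κ (c * t) r = 0 := fun κ =>
    Set.indicator_of_notMem (by simpa using hr) _
  simp [flightProfile, this]

lemma flightProfile_of_lt (hd : h < d) (hlam : 0 < lam) (hc : 0 < c) (ht : 0 < t) (hr : 0 ≤ r)
    (hrb : r < c * t) :
    flightProfile d h lam c t r
      = ENNReal.ofReal (densityConst d h lam c t * radialFactor d h lam c r t) := by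
  have hs := hasSum_deviationWeight_mul_ballProfile hd hlam hc ht hr hrb
  have hdh : (0 : ℝ) < (d : ℝ) - h := sub_pos.2 (by exact_mod_cast hd)
  have hw := deviationWeight_pos hd hlam ht
  rw [← hs.tsum_eq, ENNReal.ofReal_tsum_of_nonneg _ hs.summable, flightProfile]
  · exact tsum_congr fun n => (ENNReal.ofReal_mul (hw _).le).symm
  · exact fun n => mul_nonneg (hw _).le
      (ballProfile_nonneg (by positivity) (mul_pos hc ht) hr)

lemma withDensity_flightProfile (d h : ℕ) (lam c t : ℝ) :
    (volume : Measure (EuclideanSpace ℝ (Fin d))).withDensity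
        (fun x => flightProfile d h lam c t ‖x‖)
      = Measure.sum fun n : ℕ => ENNReal.ofReal (deviationWeight d h lam t (n + 1))
          • ballLaw d (((d : ℝ) - h) / 2 * ((n + 1 : ℕ) : ℝ)) (c * t) := by
  have h1 : (fun x : EuclideanSpace ℝ (Fin d) => flightProfile d h lam c t ‖x‖)
      = ∑' n : ℕ, ENNReal.ofReal (deviationWeight d h lam t (n + 1)) •
        fun x : EuclideanSpace ℝ (Fin d) => ENNReal.ofReal
          (ballProfile d (((d : ℝ) - h) / 2 * ((n + 1 : ℕ) : ℝ)) (c * t) ‖x‖) := by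
    ext1 x
    rw [tsum_apply (Pi.summable.2 fun _ => ENNReal.summable)]
    rfl
  rw [h1, withDensity_tsum fun n => (measurable_ballProfile_norm _ _ _).const_smul _]
  congr 1
  ext1 n
  rw [withDensity_smul _ (measurable_ballProfile_norm _ _ _)]
  rfl

lemma ofReal_reflectedDensity {R : ℝ} (hd : h < d) (hlam : 0 < lam) (hc : 0 < c) (ht : 0 < t)
    (hR : 0 < R) (hRct : R < c * t) (y : EuclideanSpace ℝ (Fin d)) :
    ENNReal.ofReal (reflectedDensity d h lam c R t y)
      = (Metric.ball 0 R).indicator (fun y => flightProfile d h lam c t ‖y‖) y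
        + (shell d (R ^ 2 / (c * t)) R).indicator
          (fun y => ENNReal.ofReal (R ^ (2 * d) / ‖y‖ ^ (2 * d))
            * flightProfile d h lam c t (R ^ 2 / ‖y‖)) y := by
  have hct : 0 < c * t := mul_pos hc ht
  have hK := densityConst_nonneg hd hlam hc ht
  have hball : ∀ y ∈ Metric.ball (0 : EuclideanSpace ℝ (Fin d)) R, ‖y‖ < c * t := fun y hy =>
    (mem_ball_zero_iff.1 hy).trans hRct
  have hshell : ∀ y ∈ shell d (R ^ 2 / (c * t)) R, R ^ 2 / ‖y‖ < c * t := by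
    intro y hy
    have h0 : 0 < ‖y‖ := lt_trans (by positivity) hy.1
    have h1 := hy.1
    rw [div_lt_iff₀ hct] at h1
    rw [div_lt_iff₀ h0]
    linarith
  have hdef : reflectedDensity d h lam c R t y = densityConst d h lam c t
      * (Metric.ball 0 R).indicator (fun y => radialFactor d h lam c ‖y‖ t) y
    + densityConst d h lam c t * (shell d (R ^ 2 / (c * t)) R).indicator
          (fun y => R ^ (2 * d) / ‖y‖ ^ (2 * d) * radialFactor d h lam c (R ^ 2 / ‖y‖) t) y := by
    rw [reflectedDensity, ← mul_add]
    rfl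
  rw [hdef, ENNReal.ofReal_add]
  · congr 1
    · by_cases hy : y ∈ Metric.ball (0 : EuclideanSpace ℝ (Fin d)) R
      · rw [Set.indicator_of_mem hy, Set.indicator_of_mem hy,
          flightProfile_of_lt hd hlam hc ht (norm_nonneg y) (hball y hy)]
      · rw [Set.indicator_of_notMem hy, Set.indicator_of_notMem hy, mul_zero, ENNReal.ofReal_zero]
    · by_cases hy : y ∈ shell d (R ^ 2 / (c * t)) R
      · rw [Set.indicator_of_mem hy, Set.indicator_of_mem hy,
          flightProfile_of_lt hd hlam hc ht (by positivity) (hshell y hy),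
          ← ENNReal.ofReal_mul (by positivity)]
        congr 1
        ring
      · rw [Set.indicator_of_notMem hy, Set.indicator_of_notMem hy, mul_zero, ENNReal.ofReal_zero]
  · refine mul_nonneg hK (Set.indicator_nonneg (fun y hy => ?_) y)
    exact radialFactor_nonneg hd hlam hc ht (norm_nonneg y) (hball y hy)
  · refine mul_nonneg hK (Set.indicator_nonneg (fun y hy => ?_) y)
    exact mul_nonneg (by positivity)
      (radialFactor_nonneg hd hlam hc ht (by positivity) (hshell y hy))

end Weights

end

theorem mainTheorem2 {Ω : Type*} [MeasurableSpace Ω] (P : Measure Ω) [IsProbabilityMeasure P]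
    (d h : ℕ) (hh : h = 1 ∨ h = 2) (hd : h < d)
    (c R lam t : ℝ) (hc : 0 < c) (hR : 0 < R) (hlam : 0 < lam) (ht : R / c < t)
    (T : ℕ → Ω → ℝ) (V : ℕ → Ω → EuclideanSpace ℝ (Fin d))
    (hflight : IsRandomFlight P T V)
    (hdir : HasDirichletDisplacements P T d h t)
    (hN : HasWeightedPoissonDeviations P T d h lam t) :
    P.map (reflectedPosition R c T V t) =
      volume.withDensity (fun x => ENNReal.ofReal (reflectedDensity d h lam c R t x))
        + ENNReal.ofReal
            (1 / (mittagLeffler (((d : ℝ) - h) / 2) ((d : ℝ) / 2) (lam * t)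
              * Real.Gamma ((d : ℝ) / 2)))
          • uniformSphere d (R ^ 2 / (c * t)) := by
  have ht0 : 0 < t := lt_trans (by positivity) ht
  have hd0 : 0 < d := by omega
  have hct : 0 < c * t := mul_pos hc ht0
  have hRct : R < c * t := by
    rw [div_lt_iff₀ hc] at ht
    linarith
  set S : ℕ → Set Ω := fun n => {ω | numDeviations T t ω = n} with hS
  have hSm : ∀ n, MeasurableSet (S n) :=
    measurableSet_numDeviations_eq hflight.measurable_time t
  have hPS : ∀ n, P (S n) = ENNReal.ofReal (deviationWeight d h lam t n) := hN
  have hdisj := pairwise_disjoint_numDeviations_eq T t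
  have hw := deviationWeight_pos hd hlam ht0
  -- the number of deviations is almost surely finite
  have hcover : P (⋃ n, S n) = 1 := by
    have hs := hasSum_deviationWeight (h := h) hd hlam ht0
    have hU : P (⋃ n, S n) = ∑' n, P (S n) := measure_iUnion hdisj hSm
    rw [hU, tsum_congr hPS, ← ENNReal.ofReal_tsum_of_nonneg (fun n => (hw n).le) hs.summable,
        hs.tsum_eq,
      ENNReal.ofReal_one]
  have hP : P = Measure.sum fun n => P.restrict (S n) := by
    rw [← Measure.restrict_iUnion hdisj hSm]
    refine (Measure.restrict_eq_self_of_ae_mem ?_).symm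
    rw [← prob_compl_eq_zero_iff (MeasurableSet.iUnion hSm)] at hcover
    exact hcover
  -- without deviations the particle is reflected from the sphere of radius `c t`
  have hmap0 : AEMeasurable (reflectedPosition R c T V t) (P.restrict (S 0)) ∧
      (P.restrict (S 0)).map (reflectedPosition R c T V t)
        = P (S 0) • uniformSphere d (R ^ 2 / (c * t)) := by
    have hX := aemeasurable_flightPosition_restrict hflight c t 0
    have hg : Measurable ((Metric.sphere (0 : EuclideanSpace ℝ (Fin d)) (c * t)).indicator
        (EuclideanGeometry.inversion 0 R)) :=
      (measurable_inversion R).indicator Metric.isClosed_sphere.measurableSet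
    have hae : reflectedPosition R c T V t =ᵐ[P.restrict (S 0)]
        (Metric.sphere (0 : EuclideanSpace ℝ (Fin d)) (c * t)).indicator
          (EuclideanGeometry.inversion 0 R) ∘ flightPosition c T V t := by
      filter_upwards [ae_restrict_mem (hSm 0)] with ω hω
      have hω' : numDeviations T t ω = 0 := by simpa [hS] using hω
      simp [reflectedPosition, not_le.2 ht, hω']
    refine ⟨(hg.comp_aemeasurable hX).congr hae.symm, ?_⟩
    rw [Measure.map_congr hae, ← AEMeasurable.map_map_of_aemeasurable hg.aemeasurable hX,
      map_flightPosition_zero hflight hd0, Measure.map_smul, map_inversion_uniformSphere hct]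
  have hmapn : ∀ n, AEMeasurable (reflectedPosition R c T V t) (P.restrict (S (n + 1))) ∧
      (P.restrict (S (n + 1))).map (reflectedPosition R c T V t)
        = (ENNReal.ofReal (deviationWeight d h lam t (n + 1))
          • ballLaw d (((d : ℝ) - h) / 2 * ((n + 1 : ℕ) : ℝ)) (c * t)).map
            (ballReflection d R (c * t)) := by
    intro n
    have hX := aemeasurable_flightPosition_restrict hflight c t (n + 1)
    have hg := measurable_ballReflection d R (c * t)
    have hae : reflectedPosition R c T V t =ᵐ[P.restrict (S (n + 1))]
        ballReflection d R (c * t) ∘ flightPosition c T V t := by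
      filter_upwards [ae_restrict_mem (hSm (n + 1))] with ω hω
      have hω' : 1 ≤ numDeviations T t ω := by
        rw [show numDeviations T t ω = ((n + 1 : ℕ) : ℕ∞) from hω]
        exact_mod_cast Nat.succ_pos n
      simp [reflectedPosition, not_le.2 ht, hω', ballReflection]
    refine ⟨(hg.comp_aemeasurable hX).congr hae.symm, ?_⟩
    have hne : P (S (n + 1)) ≠ 0 := by
      rw [hPS]
      simpa using hw (n + 1)
    rw [Measure.map_congr hae, ← AEMeasurable.map_map_of_aemeasurable hg.aemeasurable hX,
      map_flightPosition_of_pos hflight hh hd hc ht0 hdir (Nat.succ_pos n) hne, ← hPS]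
  have hmeas : AEMeasurable (reflectedPosition R c T V t)
      (Measure.sum fun n => P.restrict (S n)) := by
    rw [aemeasurable_sum_measure_iff]
    rintro (_ | n)
    exacts [hmap0.1, (hmapn n).1]
  have hsplit : ∀ m : ℕ → Measure (EuclideanSpace ℝ (Fin d)),
      Measure.sum m = Measure.sum (fun n => m (n + 1)) + m 0 := by
    intro m
    ext A hA
    rw [Measure.add_apply, Measure.sum_apply _ hA, Measure.sum_apply _ hA,
      tsum_eq_zero_add' ENNReal.summable, add_comm]
  rw [hP, Measure.map_sum hmeas, hsplit]
  congr 1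
  · simp only [(hmapn _).2]
    rw [← Measure.map_sum (measurable_ballReflection d R (c * t)).aemeasurable,
      ← withDensity_flightProfile, map_ballReflection hR hRct
        (measurable_flightProfile d h lam c t) fun r hr => flightProfile_of_le hr]
    simp only [ofReal_reflectedDensity hd hlam hc ht0 hR hRct]
  · rw [hmap0.2, hPS]
    congr 2
    simp [deviationWeight, mul_comm]
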